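/- Consider the one-dimensional restricted solid-on-solid (RSOS) model: integer heights $f(t,x)$, $t\ge 0$, $x\in\mathbb{Z}$, start from the zero configuration $f(0,x)=0$ for all $x$, and evolve in continuous time driven by independent Poisson clocks of rate one, one at each site $x\in\mathbb{Z}$. When the clock at $x$ rings at time $t$, the height at $x$ is raised by one, $f(t,x)=f(t^-,x)+1$, provided that the new height differs from each of the two neighbouring heights $f(t^-,x-1)$ and $f(t^-,x+1)$ by at most one; otherwise the height at $x$ is left unchanged. The height at $x$ does not change between rings of the clock at $x$. Let $f(t)=f(t,0)$ be the height at the origin. Then $f(t)$ is square integrable for every $t\ge 0$, and $$\liminf_{t\to\infty}\frac{\operatorname{Var}(f(t))}{\log t}>0,$$ where the limit inferior is taken in $[-\infty,\infty]$ (it may be $+\infty$). -/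

import Mathlib

open Set Filter Topology MeasureTheory ProbabilityTheory

/-- The RSOS driving rule at the site `x` of `ℤ`: the height `h x` is raised by one, provided that
the new height differs from the heights of the two neighbours by at most one. -/
def rsosUpdate (h : ℤ → ℤ) (x : ℤ) : ℤ :=
  if |h x + 1 - h (x - 1)| ≤ 1 ∧ |h x + 1 - h (x + 1)| ≤ 1 then h x + 1 else h x

/-- `f t x` (for `t ≥ 0`) is an RSOS surface growth with initial heights `h` driven by the clock
rings `U`, where `U x` is the set of ring times of the clock at `x`. If the clock at `x` rings at
time `t`, the driving rule is applied to the heights just before `t` (for locally finite rings the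
heights of `x`, `x - 1`, `x + 1` are constant on some `(t - ε, t)`, so the condition for all `s`
close to and below `t` is the condition on the left limits). Without a ring at `x`, the height at
`x` does not change. -/
structure IsRSOSEvolution (U : ℤ → Set ℝ) (h : ℤ → ℤ) (f : ℝ → ℤ → ℤ) : Prop where
  init : ∀ x, f 0 x = h x
  ring : ∀ t x, 0 < t → t ∈ U x → ∀ᶠ s in 𝓝[<] t, f t x = rsosUpdate (f s) x
  const : ∀ s t x, 0 ≤ s → s ≤ t → Disjoint (U x) (Ioc s t) → f t x = f s x

/-- The height `RSOS(t, x)` of the RSOS surface with initial heights `h` driven by the clock rings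
`U`. For almost every realization of Poisson clocks there is exactly one evolution (on `t ≥ 0`),
and this is it. -/
noncomputable def rsosHeight (U : ℤ → Set ℝ) (h : ℤ → ℤ) (t : ℝ) (x : ℤ) : ℤ :=
  Classical.epsilon (IsRSOSEvolution U h) t x

/-- The number of rings of the clock at `x` during the time interval `(a, b]`. -/
noncomputable def ringCount (U : ℤ → Set ℝ) (x : ℤ) (a b : ℝ) : ℕ :=
  (U x ∩ Ioc a b).ncard

/-- The random sets of ring times `U ω x`, `x ∈ ℤ`, are independent Poisson clocks of rate one.
Equivalently, the rings form a Poisson point process on `(0, ∞) × ℤ` whose intensity is Lebesgue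
measure times counting measure: the number of rings at `x` during `(a, b]` is Poisson with mean
`b - a`, and the numbers of rings in pairwise disjoint space-time cells `{x} × (a, b]` (at the same
site or at different ones) are independent. -/
structure IsPoissonClocks {Ω : Type*} [MeasurableSpace Ω] (U : Ω → ℤ → Set ℝ) (μ : Measure Ω) :
    Prop where
  locallyFinite : ∀ᵐ ω ∂μ, ∀ x, U ω x ⊆ Ioi 0 ∧ ∀ T : ℝ, (U ω x ∩ Ioc 0 T).Finite
  law : ∀ (x : ℤ) (a b : ℝ), 0 ≤ a → a ≤ b →
    HasLaw (fun ω => ringCount (U ω) x a b) (poissonMeasure (b - a).toNNReal) μ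
  indep : ∀ (n : ℕ) (x : Fin n → ℤ) (a b : Fin n → ℝ), (∀ i, 0 ≤ a i) →
    Pairwise (fun i j => Disjoint ({x i} ×ˢ Ioc (a i) (b i)) ({x j} ×ˢ Ioc (a j) (b j))) →
    iIndepFun (fun i ω => ringCount (U ω) (x i) (a i) (b i)) μ

/-! Write `v = Var f(t)`, `L = log t` and `l = ⌊√L⌋`. The proof bounds the gain of mean height
between the times `t` and `t + 60 l` from both sides.

From below: suppose `v < l²/1000`. By translation invariance and Chebyshev's inequality, the surface
at time `t` is probably within `l` of its mean at the 121 sites `i l`, `|i| ≤ 60`. Heights are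
1-Lipschitz, so the surface lies above a wide plateau. The growth is attractive, and an exponential
moment shows that a plateau rises by at least `5 l` with high probability. Hence the mean gains at
least `l` (`IsPoissonClocks.le_integral_rsosHeight_sub`).

From above: running longer is the same as running the clocks faster. While the remaining time `V`
exceeds `√t`, let the clocks run faster by the factor `1 + a / V`; this gains the time `a L / 2`.
Information travels at finite speed, so up to a negligible error only the sites within `10 V` of the
origin need the faster clocks. The chi-square cost is then of order `∑ V (a / V)²`, that is `a² L`.
By Cauchy–Schwarz the mean moves by at most `√(v exp(21 a² L))` plus the error
(`IsPoissonClocks.integral_rsosHeight_sub_le`). The choice `a = 120 l / L` makes the gained time `60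
l` and keeps `a² L` bounded.

Together, `v` is at least a constant times `l²`, hence a constant times `log t`.

The estimates are made for a discrete-time growth driven by one coin per cell of a time grid,
telling whether the clock rings there. Then only finitely many independent coins matter. On fine
grids this growth equals the RSOS surface, and it is dominated by a Poisson count, so means and
variances pass to the limit. -/

/-- The height after `j` steps of the discrete-time growth started from `h`: in the step `j`, every
site `x` with `ξ (j, x) = true` is raised to one more than the minimum over its neighbourhood. -/
def gridHeight (ξ : ℕ × ℤ → Bool) (h : ℤ → ℤ) : ℕ → ℤ → ℤ
  | 0 => h
  | j + 1 => fun x =>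
    if ξ (j, x) then
      1 + min (gridHeight ξ h j (x - 1)) (min (gridHeight ξ h j x) (gridHeight ξ h j (x + 1)))
    else gridHeight ξ h j x

/-! ### Height profiles with slopes at most one -/

/-- Neighbouring heights differ by at most one. -/
def IsGentle (h : ℤ → ℤ) : Prop := ∀ x, |h (x + 1) - h x| ≤ 1

theorem isGentle_zero : IsGentle (fun _ => 0) := fun x => by simp

theorem IsGentle.le_left {h : ℤ → ℤ} (hh : IsGentle h) (x : ℤ) :
    h x ≤ h (x - 1) + 1 ∧ h (x - 1) ≤ h x + 1 := by
  have := hh (x - 1)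
  rw [abs_le, sub_add_cancel] at this
  omega

theorem IsGentle.le_right {h : ℤ → ℤ} (hh : IsGentle h) (x : ℤ) :
    h x ≤ h (x + 1) + 1 ∧ h (x + 1) ≤ h x + 1 := by
  have := hh x
  rw [abs_le] at this
  omega

theorem IsGentle.le_add_nat {h : ℤ → ℤ} (hh : IsGentle h) (x : ℤ) (n : ℕ) :
    h x ≤ h (x + n) + n ∧ h (x + n) ≤ h x + n := by
  induction n with
  | zero => simp
  | succ n ih =>
    have := hh.le_right (x + n)
    rw [Nat.cast_succ, ← add_assoc x]
    omega

theorem IsGentle.le_add_abs {h : ℤ → ℤ} (hh : IsGentle h) (x y : ℤ) :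
    h x ≤ h y + |x - y| := by
  rcases le_total x y with hxy | hxy
  · obtain ⟨n, rfl⟩ := Int.le.dest hxy
    have := (hh.le_add_nat x n).1
    rw [abs_of_nonpos (by omega)]
    omega
  · obtain ⟨n, rfl⟩ := Int.le.dest hxy
    have := (hh.le_add_nat y n).2
    rw [abs_of_nonneg (by omega)]
    omega

/-- For gentle heights a raise is allowed exactly when `x` is a weak local minimum; otherwise the
lowest neighbour is at `h x - 1` and the formula returns `h x`. The form with the minimum makes
monotonicity in the heights visible. -/
theorem rsosUpdate_eq_min {h : ℤ → ℤ} {x : ℤ} (h₁ : |h x - h (x - 1)| ≤ 1)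
    (h₂ : |h (x + 1) - h x| ≤ 1) :
    rsosUpdate h x = 1 + min (h (x - 1)) (min (h x) (h (x + 1))) := by
  unfold rsosUpdate
  rw [abs_le] at h₁ h₂
  simp only [abs_le]
  split_ifs <;> omega

/-! ### Discrete-time growth: attractiveness, finite range and sensitivity to the coins -/

section GridHeight

variable {ξ ξ' : ℕ × ℤ → Bool} {h h' : ℤ → ℤ}

theorem gridHeight_succ (ξ : ℕ × ℤ → Bool) (h : ℤ → ℤ) (j : ℕ) (x : ℤ) :
    gridHeight ξ h (j + 1) x =
      if ξ (j, x) then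
        1 + min (gridHeight ξ h j (x - 1)) (min (gridHeight ξ h j x) (gridHeight ξ h j (x + 1)))
      else gridHeight ξ h j x := rfl

/-- Only weak local minima rise. Two neighbours that rise in the same step were therefore at equal
height, and a single riser does not overshoot. -/
theorem isGentle_gridHeight (hh : IsGentle h) (ξ : ℕ × ℤ → Bool) (j : ℕ) :
    IsGentle (gridHeight ξ h j) := by
  induction j with
  | zero => exact hh
  | succ j ih =>
    intro x
    rw [gridHeight_succ, gridHeight_succ, add_sub_cancel_right]
    have h1 := ih.le_left x
    have h2 := ih.le_right x
    have h3 := ih.le_right (x + 1)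
    rw [abs_le]
    split_ifs <;> omega

theorem gridHeight_le_succ (hh : IsGentle h) (ξ : ℕ × ℤ → Bool) (j : ℕ) (x : ℤ) :
    gridHeight ξ h j x ≤ gridHeight ξ h (j + 1) x ∧
      gridHeight ξ h (j + 1) x ≤ gridHeight ξ h j x + if ξ (j, x) then 1 else 0 := by
  have h1 := (isGentle_gridHeight hh ξ j).le_left x
  have h2 := (isGentle_gridHeight hh ξ j).le_right x
  rw [gridHeight_succ]
  split_ifs <;> omega

theorem monotone_gridHeight (hh : IsGentle h) (ξ : ℕ × ℤ → Bool) (x : ℤ) :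
    Monotone fun j => gridHeight ξ h j x :=
  monotone_nat_of_le_succ fun j => (gridHeight_le_succ hh ξ j x).1

theorem gridHeight_zero_nonneg (ξ : ℕ × ℤ → Bool) (j : ℕ) (x : ℤ) :
    0 ≤ gridHeight ξ (fun _ => 0) j x :=
  monotone_gridHeight isGentle_zero ξ x (Nat.zero_le j)

/-- Attractiveness: the minimum is monotone in the heights. This permits replacing a random surface
by a deterministic plateau below it. -/
theorem gridHeight_mono_left (hle : ∀ x, h x ≤ h' x) (j : ℕ) (x : ℤ) :
    gridHeight ξ h j x ≤ gridHeight ξ h' j x := by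
  induction j generalizing x with
  | zero => exact hle x
  | succ j ih =>
    rw [gridHeight_succ, gridHeight_succ]
    have h1 := ih (x - 1)
    have h2 := ih x
    have h3 := ih (x + 1)
    split_ifs <;> omega

theorem gridHeight_add_const (c : ℤ) (j : ℕ) (x : ℤ) :
    gridHeight ξ (fun y => h y + c) j x = gridHeight ξ h j x + c := by
  induction j generalizing x with
  | zero => rfl
  | succ j ih =>
    rw [gridHeight_succ, gridHeight_succ, ih, ih, ih]
    split_ifs <;> omega

theorem gridHeight_add_steps (K M : ℕ) (x : ℤ) :
    gridHeight ξ h (K + M) x =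
      gridHeight (fun z => ξ (K + z.1, z.2)) (gridHeight ξ h K) M x := by
  induction M generalizing x with
  | zero => rfl
  | succ M ih =>
    rw [← add_assoc, gridHeight_succ, gridHeight_succ, ih, ih, ih]

theorem gridHeight_translate (y : ℤ) (j : ℕ) (x : ℤ) :
    gridHeight (fun z => ξ (z.1, z.2 + y)) (fun z => h (z + y)) j x = gridHeight ξ h j (x + y) := by
  induction j generalizing x with
  | zero => rfl
  | succ j ih =>
    rw [gridHeight_succ, gridHeight_succ, ih, ih, ih, sub_add_eq_add_sub, add_right_comm]

/-- Each step looks one site to either side, so the height is a function of finitely many coins. -/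
theorem gridHeight_congr {j : ℕ} {x : ℤ}
    (hξ : ∀ z ∈ Finset.range j ×ˢ Finset.Icc (x - j) (x + j), ξ z = ξ' z) :
    gridHeight ξ h j x = gridHeight ξ' h j x := by
  induction j generalizing x with
  | zero => rfl
  | succ j ih =>
    have key : ∀ y, x - 1 ≤ y → y ≤ x + 1 → gridHeight ξ h j y = gridHeight ξ' h j y := by
      intro y h1 h2
      refine ih fun z hz => hξ z ?_
      simp only [Finset.mem_product, Finset.mem_range, Finset.mem_Icc] at hz ⊢
      push_cast
      omega
    rw [gridHeight_succ, gridHeight_succ, key x (by omega) (by omega),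
      key (x - 1) (by omega) (by omega), key (x + 1) (by omega) (by omega), hξ (j, x)]
    simp only [Finset.mem_product, Finset.mem_range, Finset.mem_Icc]
    push_cast
    omega

/-- If both coins agree and show `true`, the change of the minimum is at most the largest of the
three differences, hence at most their sum. If they disagree, one height stays and the other rises
by at most one, which costs the last term. -/
theorem abs_gridHeight_sub_succ_le (hh : IsGentle h) (j : ℕ) (x : ℤ) :
    |gridHeight ξ' h (j + 1) x - gridHeight ξ h (j + 1) x| ≤
      |gridHeight ξ' h j x - gridHeight ξ h j x| +
        (if ξ' (j, x) ∨ ξ (j, x) then |gridHeight ξ' h j (x - 1) - gridHeight ξ h j (x - 1)| +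
          |gridHeight ξ' h j (x + 1) - gridHeight ξ h j (x + 1)| else 0) +
        if ξ' (j, x) = ξ (j, x) then 0 else 1 := by
  have h1 := (isGentle_gridHeight hh ξ j).le_left x
  have h2 := (isGentle_gridHeight hh ξ j).le_right x
  have h1' := (isGentle_gridHeight hh ξ' j).le_left x
  have h2' := (isGentle_gridHeight hh ξ' j).le_right x
  rw [gridHeight_succ, gridHeight_succ]
  have a1 := abs_le.1 (le_refl |gridHeight ξ' h j x - gridHeight ξ h j x|)
  have a2 := abs_le.1 (le_refl |gridHeight ξ' h j (x - 1) - gridHeight ξ h j (x - 1)|)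
  have a3 := abs_le.1 (le_refl |gridHeight ξ' h j (x + 1) - gridHeight ξ h j (x + 1)|)
  rw [abs_le]
  cases h4 : ξ' (j, x) <;> cases h5 : ξ (j, x) <;> simp only [if_true, if_false, reduceCtorEq,
    or_self, or_true, true_or, Bool.false_eq_true] <;> omega

end GridHeight

/-! ### Functions of finitely many independent coins, and the chi-square inequality -/

/-- The `X i` are independent coins that show `true` with probability `p i`. -/
structure IsCoins {ι Ω : Type*} [MeasurableSpace Ω] (μ : Measure Ω) (X : ι → Ω → Bool)
    (p : ι → ℝ) : Prop where
  measurable : ∀ i, Measurable (X i)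
  indep : iIndepFun X μ
  prob : ∀ i, μ.real {ω | X i ω = true} = p i

/-- The configuration that agrees with `σ` on `S` and is `false` elsewhere. -/
def extendCoins {ι : Type*} [DecidableEq ι] (S : Finset ι) (σ : S → Bool) (i : ι) : Bool :=
  if h : i ∈ S then σ ⟨i, h⟩ else false

/-- The probability that a coin with success probability `p` shows `b`. -/
def coinWeight (p : ℝ) (b : Bool) : ℝ := if b then p else 1 - p

section Coins

set_option linter.unusedSectionVars false

variable {ι Ω : Type*} [DecidableEq ι] [MeasurableSpace Ω] {μ : Measure Ω} [IsProbabilityMeasure μ]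
  {X Y : ι → Ω → Bool} {p q : ι → ℝ} {φ χ : (ι → Bool) → ℝ} {S T : Finset ι}

theorem DependsOn.eq_extendCoins (hφ : DependsOn φ (S : Set ι)) (ξ : ι → Bool) :
    φ ξ = φ (extendCoins S (S.restrict ξ)) := by
  refine hφ fun i hi => ?_
  simp only [extendCoins, Finset.restrict]
  rw [dif_pos (Finset.mem_coe.1 hi)]

theorem IsCoins.measurable_restrict (hX : IsCoins μ X p) (S : Finset ι) :
    Measurable fun ω => S.restrict fun i => X i ω :=
  measurable_pi_lambda _ fun i => hX.measurable i

theorem IsCoins.measurable_comp (hX : IsCoins μ X p) (hφ : DependsOn φ (S : Set ι)) :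
    Measurable fun ω => φ fun i => X i ω := by
  have : (fun ω => φ fun i => X i ω) =
      (fun σ => φ (extendCoins S σ)) ∘ fun ω => S.restrict fun i => X i ω :=
    funext fun ω => hφ.eq_extendCoins _
  rw [this]
  exact (measurable_of_finite _).comp (hX.measurable_restrict S)

theorem exists_abs_le_of_dependsOn (hφ : DependsOn φ (S : Set ι)) : ∃ C, ∀ ξ, |φ ξ| ≤ C := by
  obtain ⟨C, hC⟩ := (Set.finite_range fun σ => |φ (extendCoins S σ)|).bddAbove
  exact ⟨C, fun ξ => by rw [hφ.eq_extendCoins ξ]; exact hC ⟨_, rfl⟩⟩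

theorem IsCoins.memLp (hX : IsCoins μ X p) (hφ : DependsOn φ (S : Set ι)) (r : ENNReal) :
    MemLp (fun ω => φ fun i => X i ω) r μ := by
  obtain ⟨C, hC⟩ := exists_abs_le_of_dependsOn hφ
  exact MemLp.of_bound (hX.measurable_comp hφ).aestronglyMeasurable C
    (Eventually.of_forall fun ω => hC _)

theorem IsCoins.integrable (hX : IsCoins μ X p) (hφ : DependsOn φ (S : Set ι)) :
    Integrable (fun ω => φ fun i => X i ω) μ :=
  memLp_one_iff_integrable.1 (hX.memLp hφ 1)

theorem IsCoins.integral_mul (hX : IsCoins μ X p) (hφ : DependsOn φ (S : Set ι))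
    (hχ : DependsOn χ (T : Set ι)) (hST : Disjoint S T) :
    ∫ ω, φ (fun i => X i ω) * χ (fun i => X i ω) ∂μ =
      (∫ ω, φ fun i => X i ω ∂μ) * ∫ ω, χ fun i => X i ω ∂μ := by
  have h := hX.indep.indepFun_finset S T hST hX.measurable
  have h' := h.comp (φ := fun σ => φ (extendCoins S σ)) (ψ := fun σ => χ (extendCoins T σ))
    (measurable_of_finite _) (measurable_of_finite _)
  have e1 : (fun ω => φ fun i => X i ω) =
      (fun σ => φ (extendCoins S σ)) ∘ fun ω (i : S) => X i ω :=
    funext fun ω => hφ.eq_extendCoins _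
  have e2 : (fun ω => χ fun i => X i ω) =
      (fun σ => χ (extendCoins T σ)) ∘ fun ω (i : T) => X i ω :=
    funext fun ω => hχ.eq_extendCoins _
  rw [← e1, ← e2] at h'
  exact h'.integral_fun_mul_eq_mul_integral (hX.measurable_comp hφ).aestronglyMeasurable
    (hX.measurable_comp hχ).aestronglyMeasurable

theorem IsCoins.prob_eq (hX : IsCoins μ X p) (i : ι) (b : Bool) :
    μ.real (X i ⁻¹' {b}) = coinWeight (p i) b := by
  have ht : μ.real (X i ⁻¹' {true}) = p i := hX.prob i
  cases b with
  | true => simpa [coinWeight] using ht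
  | false =>
    have : X i ⁻¹' {false} = (X i ⁻¹' {true})ᶜ := by
      ext ω; simp
    rw [this, probReal_compl_eq_one_sub (hX.measurable i (measurableSet_singleton _)), ht]
    simp [coinWeight]

/-- The sum involves the success probabilities only. Means and variances therefore agree for any two
coin families with the same probabilities. -/
theorem IsCoins.integral_eq_sum (hX : IsCoins μ X p) (hφ : DependsOn φ (S : Set ι)) :
    ∫ ω, φ (fun i => X i ω) ∂μ =
      ∑ σ : S → Bool, (∏ i : S, coinWeight (p i) (σ i)) * φ (extendCoins S σ) := by
  set A : (S → Bool) → Set Ω := fun σ => ⋂ i : S, X (i : ι) ⁻¹' {σ i} with hA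
  have hAm : ∀ σ, MeasurableSet (A σ) := fun σ =>
    MeasurableSet.iInter fun i => hX.measurable i (measurableSet_singleton _)
  have hAμ : ∀ σ, μ.real (A σ) = ∏ i : S, coinWeight (p i) (σ i) := by
    intro σ
    have := (hX.indep.precomp (g := ((↑) : S → ι)) Subtype.val_injective).meas_iInter
      (s := fun i : S => X (i : ι) ⁻¹' {σ i}) fun i => ⟨{σ i}, measurableSet_singleton _, rfl⟩
    rw [measureReal_def, hA, this, ENNReal.toReal_prod]
    exact Finset.prod_congr rfl fun i _ => hX.prob_eq i (σ i)
  have e : ∀ ω, φ (fun i => X i ω) =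
      ∑ σ, (A σ).indicator (fun _ => φ (extendCoins S σ)) ω := by
    intro ω
    rw [Finset.sum_eq_single (S.restrict fun i => X i ω), Set.indicator_of_mem]
    · exact hφ.eq_extendCoins _
    · simp [hA]
    · intro σ _ hσ
      refine Set.indicator_of_notMem (fun h => hσ ?_) _
      funext i
      have := Set.mem_iInter.1 h i
      simpa [eq_comm] using this
    · simp
  simp_rw [e]
  rw [integral_finsetSum _ fun σ _ => (integrable_const _).indicator (hAm σ)]
  refine Finset.sum_congr rfl fun σ _ => ?_
  rw [integral_indicator_const _ (hAm σ), hAμ, smul_eq_mul]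

theorem IsCoins.integral_congr (hX : IsCoins μ X p) (hY : IsCoins μ Y p)
    (hφ : DependsOn φ (S : Set ι)) :
    ∫ ω, φ (fun i => X i ω) ∂μ = ∫ ω, φ (fun i => Y i ω) ∂μ := by
  rw [hX.integral_eq_sum hφ, hY.integral_eq_sum hφ]

theorem IsCoins.variance_eq (hX : IsCoins μ X p) (hφ : DependsOn φ (S : Set ι)) :
    Var[fun ω => φ fun i => X i ω; μ] =
      ∫ ω, (φ (fun i => X i ω) - ∫ ω, φ (fun i => X i ω) ∂μ) ^ 2 ∂μ :=
  variance_eq_integral (hX.measurable_comp hφ).aemeasurable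

theorem DependsOn.comp_left {β γ : Type*} {φ : (ι → Bool) → β} {s : Set ι} (hφ : DependsOn φ s)
    (g : β → γ) : DependsOn (fun ξ => g (φ ξ)) s := fun _ _ h => congrArg g (hφ h)

theorem IsCoins.variance_congr (hX : IsCoins μ X p) (hY : IsCoins μ Y p)
    (hφ : DependsOn φ (S : Set ι)) :
    Var[fun ω => φ fun i => X i ω; μ] = Var[fun ω => φ fun i => Y i ω; μ] := by
  rw [hX.variance_eq hφ, hY.variance_eq hφ, hX.integral_congr hY hφ]
  exact hX.integral_congr hY (hφ.comp_left fun a => (a - ∫ ω, φ (fun i => Y i ω) ∂μ) ^ 2)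

theorem sum_prod_coinWeight (g : S → Bool → ℝ) :
    ∑ σ : S → Bool, ∏ i, g i (σ i) = ∏ i : S, (g i true + g i false) := by
  have := (Finset.prod_univ_sum (fun _ : S => (Finset.univ : Finset Bool)) g).symm
  rw [Fintype.piFinset_univ] at this
  rw [this]
  simp

/-- The squared change of the mean under a change of the success probabilities is at most the
variance times the chi-square distance. -/
theorem IsCoins.sq_integral_sub_le (hX : IsCoins μ X p) (hY : IsCoins μ Y q)
    (hφ : DependsOn φ (S : Set ι)) (hp : ∀ i, 0 < p i ∧ p i < 1) :
    (∫ ω, φ (fun i => Y i ω) ∂μ - ∫ ω, φ (fun i => X i ω) ∂μ) ^ 2 ≤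
      Var[fun ω => φ fun i => X i ω; μ] *
        (∏ i ∈ S, (1 + (q i - p i) ^ 2 / (p i * (1 - p i))) - 1) := by
  set m := ∫ ω, φ (fun i => X i ω) ∂μ with hm
  set a : (S → Bool) → ℝ := fun σ => ∏ i : S, coinWeight (p i) (σ i) with ha
  set b : (S → Bool) → ℝ := fun σ => ∏ i : S, coinWeight (q i) (σ i) with hb
  have hapos : ∀ σ, 0 < a σ := fun σ => Finset.prod_pos fun i _ => by
    have := hp i
    unfold coinWeight
    split_ifs <;> linarith
  have hasum : ∑ σ, a σ = 1 := by
    rw [ha, sum_prod_coinWeight fun (i : S) => coinWeight (p i)]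
    exact Finset.prod_eq_one fun i _ => by simp [coinWeight]
  have hbsum : ∑ σ, b σ = 1 := by
    rw [hb, sum_prod_coinWeight fun (i : S) => coinWeight (q i)]
    exact Finset.prod_eq_one fun i _ => by simp [coinWeight]
  have hvar : Var[fun ω => φ fun i => X i ω; μ] =
      ∑ σ, a σ * (φ (extendCoins S σ) - m) ^ 2 := by
    rw [hX.variance_eq hφ, ← hm]
    exact hX.integral_eq_sum (hφ.comp_left fun c => (c - m) ^ 2)
  -- Subtracting the constant `m` is free, since `a` and `b` have the same total mass.
  have hdiff : ∫ ω, φ (fun i => Y i ω) ∂μ - m =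
      ∑ σ, (b σ - a σ) * (φ (extendCoins S σ) - m) := by
    have e : ∀ σ, (b σ - a σ) * (φ (extendCoins S σ) - m) =
        b σ * φ (extendCoins S σ) - a σ * φ (extendCoins S σ) - m * b σ + m * a σ :=
      fun σ => by ring
    simp_rw [e]
    rw [Finset.sum_add_distrib, Finset.sum_sub_distrib, Finset.sum_sub_distrib, ← Finset.mul_sum,
      ← Finset.mul_sum, hasum, hbsum, ← hX.integral_eq_sum hφ, ← hY.integral_eq_sum hφ]
    ring
  -- The sum of `b² / a` factorizes over the coins, which gives the product form.
  have hchi : ∑ σ, (b σ - a σ) ^ 2 / a σ =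
      ∏ i ∈ S, (1 + (q i - p i) ^ 2 / (p i * (1 - p i))) - 1 := by
    have e : ∀ σ, (b σ - a σ) ^ 2 / a σ =
        (∏ i : S, coinWeight (q i) (σ i) ^ 2 / coinWeight (p i) (σ i)) - 2 * b σ + a σ := by
      intro σ
      have : ∏ i : S, coinWeight (q i) (σ i) ^ 2 / coinWeight (p i) (σ i) = b σ ^ 2 / a σ := by
        rw [Finset.prod_div_distrib, Finset.prod_pow]
      rw [this]
      have := (hapos σ).ne'
      field_simp
      ring
    simp_rw [e]
    rw [Finset.sum_add_distrib, Finset.sum_sub_distrib, ← Finset.mul_sum, hasum, hbsum,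
      sum_prod_coinWeight fun (i : S) c => coinWeight (q i) c ^ 2 / coinWeight (p i) c,
      ← Finset.prod_coe_sort S]
    have : ∀ i : S, coinWeight (q i) true ^ 2 / coinWeight (p i) true +
        coinWeight (q i) false ^ 2 / coinWeight (p i) false =
        1 + (q i - p i) ^ 2 / (p i * (1 - p i)) := by
      intro i
      have h1 := (hp i).1.ne'
      have h2 : (1 - p i) ≠ 0 := by linarith [(hp i).2]
      simp only [coinWeight, if_true, Bool.false_eq_true, if_false]
      field_simp
      ring
    simp_rw [this]
    ring
  rw [hvar, hdiff, ← hchi]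
  -- Cauchy–Schwarz, with `(b - a)(φ - m)` split as `(b - a) / √a` times `√a (φ - m)`.
  refine Finset.sum_sq_le_sum_mul_sum_of_sq_le_mul _ (fun σ _ => ?_) (fun σ _ => ?_)
    (fun σ _ => ?_)
  · exact mul_nonneg (hapos σ).le (sq_nonneg _)
  · exact div_nonneg (sq_nonneg _) (hapos σ).le
  · have := (hapos σ).ne'
    apply le_of_eq
    field_simp

theorem dependsOn_gridHeight (h : ℤ → ℤ) (j : ℕ) (x : ℤ) :
    DependsOn (fun ξ => gridHeight ξ h j x)
      ((Finset.range j ×ˢ Finset.Icc (x - j) (x + j) : Finset (ℕ × ℤ)) : Set (ℕ × ℤ)) :=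
  fun _ _ hξ => gridHeight_congr fun z hz => hξ z (Finset.mem_coe.2 hz)

end Coins

/-! ### Growth of a flat surface in discrete time -/

section Growth

set_option linter.unusedSectionVars false

variable {ι Ω : Type*} [DecidableEq ι] [MeasurableSpace Ω] {μ : Measure Ω} [IsProbabilityMeasure μ]

theorem IsCoins.precomp {ι' : Type*} {X : ι → Ω → Bool} {p : ι → ℝ} (hX : IsCoins μ X p)
    {g : ι' → ι} (hg : g.Injective) : IsCoins μ (fun i => X (g i)) (fun i => p (g i)) :=
  ⟨fun _ => hX.measurable _, hX.indep.precomp hg, fun _ => hX.prob _⟩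

theorem dependsOn_coin {ι : Type*} (i : ι) (a b : ℝ) :
    DependsOn (fun ξ : ι → Bool => if ξ i then a else b) (({i} : Finset ι) : Set ι) :=
  fun ξ ξ' h => by
    have := h i (by simp)
    simp only [this]

theorem IsCoins.integral_coin {X : ι → Ω → Bool} {p : ι → ℝ} (hX : IsCoins μ X p) (i : ι)
    (a b : ℝ) : ∫ ω, (if X i ω then a else b) ∂μ = p i * a + (1 - p i) * b := by
  have hm : MeasurableSet {ω | X i ω = true} := hX.measurable i (measurableSet_singleton true)
  have e : ∀ ω, (if X i ω then a else b) =
      {ω | X i ω = true}.indicator (fun _ => a - b) ω + b := by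
    intro ω
    by_cases h : X i ω = true <;> simp [h]
  simp_rw [e]
  rw [integral_add ((integrable_const _).indicator hm) (integrable_const _),
    integral_indicator_const _ hm, hX.prob]
  simp
  ring

theorem IsCoins.integral_coin_mul {X : ι → Ω → Bool} {p : ι → ℝ} (hX : IsCoins μ X p)
    {φ : (ι → Bool) → ℝ} {S : Finset ι} (hφ : DependsOn φ (S : Set ι)) {i : ι} (hi : i ∉ S)
    (a b : ℝ) :
    ∫ ω, (if X i ω then a else b) * φ (fun i => X i ω) ∂μ =
      (p i * a + (1 - p i) * b) * ∫ ω, φ (fun i => X i ω) ∂μ := by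
  rw [← hX.integral_coin]
  exact hX.integral_mul (dependsOn_coin i a b) hφ (Finset.disjoint_singleton_left.2 hi)

variable {X : ℕ × ℤ → Ω → Bool} {p : ℕ × ℤ → ℝ} {r : ℕ → ℝ}

theorem notMem_layers (j : ℕ) (s : Finset ℤ) (x : ℤ) : (j, x) ∉ Finset.range j ×ˢ s := by
  simp

theorem dependsOn_six_zpow (b : ℤ → ℤ) (j : ℕ) (x : ℤ) :
    DependsOn (fun ξ => (6 : ℝ) ^ (-gridHeight ξ b j x))
      ((Finset.range j ×ˢ Finset.Icc (x - j) (x + j) : Finset (ℕ × ℤ)) : Set (ℕ × ℤ)) :=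
  (dependsOn_gridHeight b j x).comp_left fun a => (6 : ℝ) ^ (-a)

/-- A raise replaces the weight `6 ^ (-height)` by a sixth of the largest of three weights, hence at
most a sixth of their sum. The coin of layer `j` is independent of the heights after `j` steps, so
the mean weights satisfy a linear inequality. -/
theorem integral_six_zpow_succ_le (hX : IsCoins μ X p) (b : ℤ → ℤ) (j : ℕ)
    (x : ℤ) :
    ∫ ω, (6 : ℝ) ^ (-gridHeight (fun z => X z ω) b (j + 1) x) ∂μ ≤
      (1 - p (j, x)) * ∫ ω, (6 : ℝ) ^ (-gridHeight (fun z => X z ω) b j x) ∂μ +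
      p (j, x) * (1 / 6) * (∫ ω, (6 : ℝ) ^ (-gridHeight (fun z => X z ω) b j (x - 1)) ∂μ +
        ∫ ω, (6 : ℝ) ^ (-gridHeight (fun z => X z ω) b j x) ∂μ +
        ∫ ω, (6 : ℝ) ^ (-gridHeight (fun z => X z ω) b j (x + 1)) ∂μ) := by
  have hI : ∀ y, Integrable (fun ω => (6 : ℝ) ^ (-gridHeight (fun z => X z ω) b j y)) μ :=
    fun y => hX.integrable (dependsOn_six_zpow b j y)
  have hC : ∀ y (c d : ℝ), ∫ ω, (if X (j, x) ω then c else d) *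
      (6 : ℝ) ^ (-gridHeight (fun z => X z ω) b j y) ∂μ = (p (j, x) * c + (1 - p (j, x)) * d) *
        ∫ ω, (6 : ℝ) ^ (-gridHeight (fun z => X z ω) b j y) ∂μ := fun y c d =>
    hX.integral_coin_mul (dependsOn_six_zpow b j y) (notMem_layers j _ x) c d
  have hcm : ∀ c d : ℝ, AEStronglyMeasurable (fun ω => if X (j, x) ω then c else d) μ :=
    fun c d => (hX.measurable_comp (dependsOn_coin (j, x) c d)).aestronglyMeasurable
  have hCI : ∀ y (c d : ℝ), Integrable (fun ω => (if X (j, x) ω then c else d) *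
      (6 : ℝ) ^ (-gridHeight (fun z => X z ω) b j y)) μ := fun y c d =>
    (hI y).bdd_mul (c := max |c| |d|) (hcm c d) (Eventually.of_forall fun ω => by
      split_ifs <;> simp)
  have key : ∀ ω, (6 : ℝ) ^ (-gridHeight (fun z => X z ω) b (j + 1) x) ≤
      (if X (j, x) ω then 0 else 1) * (6 : ℝ) ^ (-gridHeight (fun z => X z ω) b j x) +
      ((if X (j, x) ω then 1 / 6 else 0) * (6 : ℝ) ^ (-gridHeight (fun z => X z ω) b j (x - 1)) +
      (if X (j, x) ω then 1 / 6 else 0) * (6 : ℝ) ^ (-gridHeight (fun z => X z ω) b j x) +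
      (if X (j, x) ω then 1 / 6 else 0) *
        (6 : ℝ) ^ (-gridHeight (fun z => X z ω) b j (x + 1))) := by
    intro ω
    rw [gridHeight_succ]
    by_cases h : X (j, x) ω = true
    · simp only [h, if_true]
      generalize gridHeight (fun z => X z ω) b j (x - 1) = u
      generalize gridHeight (fun z => X z ω) b j x = v
      generalize gridHeight (fun z => X z ω) b j (x + 1) = w
      have e : ∀ a : ℤ, (6 : ℝ) ^ (-(1 + a)) = 1 / 6 * (6 : ℝ) ^ (-a) := by
        intro a
        rw [neg_add, zpow_add₀ (by norm_num)]
        norm_num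
      have hu : (0 : ℝ) < 6 ^ (-u) := by positivity
      have hv : (0 : ℝ) < 6 ^ (-v) := by positivity
      have hw : (0 : ℝ) < 6 ^ (-w) := by positivity
      rw [e]
      rcases min_choice u (min v w) with h1 | h1 <;> rw [h1]
      · linarith
      rcases min_choice v w with h2 | h2 <;> rw [h2] <;> linarith
    · simp [h]
  refine (integral_mono (hX.integrable (dependsOn_six_zpow b (j + 1) x))
    ((hCI _ _ _).add (((hCI _ _ _).add (hCI _ _ _)).add (hCI _ _ _))) key).trans (le_of_eq ?_)
  rw [integral_add' (hCI _ _ _) (((hCI _ _ _).add (hCI _ _ _)).add (hCI _ _ _)),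
    integral_add' ((hCI _ _ _).add (hCI _ _ _)) (hCI _ _ _),
    integral_add' (hCI _ _ _) (hCI _ _ _), hC, hC, hC, hC]
  ring

/-- The profile that vanishes on `[-R, R]` and decreases with slope one outside. -/
def plateau (R : ℕ) (x : ℤ) : ℤ := -max (|x| - R) 0

/-- The right side is a supersolution of the linear inequality. Constants are multiplied by `1 - r +
3 r / 6 = 1 - r / 2`; the exponentials `6 ^ (±x)` by `1 - r + (1/6 + 1 + 6) r / 6`, at most `1 + r /
4`. The second term dominates the sloping sides of the plateau initially. -/
theorem integral_six_zpow_plateau_le (hX : IsCoins μ X p) (hp : ∀ z, p z = r z.1)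
    (hr : ∀ j, 0 ≤ r j ∧ r j ≤ 1) (R j : ℕ) (x : ℤ) :
    ∫ ω, (6 : ℝ) ^ (-gridHeight (fun z => X z ω) (plateau R) j x) ∂μ ≤
      ∏ i ∈ Finset.range j, (1 - r i / 2) +
        (6 : ℝ) ^ (-R : ℤ) * (∏ i ∈ Finset.range j, (1 + r i / 4)) *
          ((6 : ℝ) ^ x + (6 : ℝ) ^ (-x)) := by
  have h6 : (6 : ℝ) ≠ 0 := by norm_num
  induction j generalizing x with
  | zero =>
    simp only [gridHeight, integral_const, probReal_univ, one_smul, Finset.range_zero,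
      Finset.prod_empty, mul_one, plateau, neg_neg]
    have h1 : (0 : ℝ) < 6 ^ x := by positivity
    have h2 : (0 : ℝ) < 6 ^ (-x) := by positivity
    have h3 : (0 : ℝ) < 6 ^ (-R : ℤ) := by positivity
    rcases max_choice (|x| - R) 0 with h | h <;> rw [h]
    · rw [sub_eq_neg_add, zpow_add₀ h6]
      have : (6 : ℝ) ^ |x| ≤ 6 ^ x + 6 ^ (-x) := by
        rcases abs_choice x with h | h <;> rw [h] <;> linarith
      nlinarith
    · rw [zpow_zero]
      nlinarith [mul_pos h3 h1, mul_pos h3 h2]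
  | succ j ih =>
    refine (integral_six_zpow_succ_le hX _ j x).trans ?_
    rw [Finset.prod_range_succ, Finset.prod_range_succ, hp]
    set A := ∏ i ∈ Finset.range j, (1 - r i / 2)
    set B := ∏ i ∈ Finset.range j, (1 + r i / 4) with hB
    have hB0 : 0 < B := Finset.prod_pos fun i _ => by linarith [(hr i).1]
    have i1 := ih (x - 1)
    have i2 := ih x
    have i3 := ih (x + 1)
    obtain ⟨hr0, hr1⟩ := hr j
    have e1 : (6 : ℝ) ^ (x - 1) = 6 ^ x / 6 := by rw [zpow_sub₀ h6]; simp
    have e2 : (6 : ℝ) ^ (x + 1) = 6 ^ x * 6 := by rw [zpow_add₀ h6]; simp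
    have e3 : (6 : ℝ) ^ (-(x - 1)) = 6 ^ (-x) * 6 := by
      rw [neg_sub, sub_eq_neg_add, zpow_add₀ h6]; simp
    have e4 : (6 : ℝ) ^ (-(x + 1)) = 6 ^ (-x) / 6 := by
      rw [neg_add, zpow_add₀ h6]; simp [div_eq_mul_inv]
    rw [e1, e3] at i1
    rw [e2, e4] at i3
    set u := (6 : ℝ) ^ x with hu
    set v := (6 : ℝ) ^ (-x) with hv
    have hu0 : 0 < u := by positivity
    have hv0 : 0 < v := by positivity
    set D := (6 : ℝ) ^ (-R : ℤ) * B with hD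
    have hD0 : 0 < D := by positivity
    have k2 := mul_le_mul_of_nonneg_left i2 (sub_nonneg.2 hr1)
    have k3 := mul_le_mul_of_nonneg_left (add_le_add (add_le_add i1 i2) i3)
      (by positivity : 0 ≤ r j * (1 / 6))
    refine (add_le_add k2 k3).trans ?_
    rw [← mul_assoc ((6 : ℝ) ^ (-R : ℤ)) B, ← hD]
    have : 0 ≤ r j * (D * (u + v)) := by positivity
    nlinarith

/-- Markov's inequality for `6 ^ (-height)`: the mean is at most `3 exp(-15 l)`, while the threshold
`6 ^ (-5 l)` is at least `exp(-10 l)`. What remains is `3 exp(-5 l) ≤ 3 / 90`. -/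
theorem prob_plateau_lt_le (hX : IsCoins μ X p) (hp : ∀ z, p z = r z.1)
    (hr : ∀ j, 0 ≤ r j ∧ r j ≤ 1) {l : ℕ} (hl : 1 ≤ l) {M : ℕ}
    (h₁ : 30 * (l : ℝ) ≤ ∑ j ∈ Finset.range M, r j)
    (h₂ : ∑ j ∈ Finset.range M, r j ≤ 60 * (l : ℝ)) :
    μ.real {ω | gridHeight (fun z => X z ω) (plateau (60 * l)) M 0 < 5 * l} ≤ 1 / 30 := by
  have hl' : (1 : ℝ) ≤ l := by exact_mod_cast hl
  have hexp2 : (6 : ℝ) ≤ Real.exp 2 := by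
    have := Real.exp_one_gt_d9
    rw [show (2 : ℝ) = 1 + 1 by norm_num, Real.exp_add]
    nlinarith
  have hexp5 : (90 : ℝ) ≤ Real.exp 5 := by
    have h1 : Real.exp 5 = Real.exp 2 * Real.exp 2 * Real.exp 1 := by
      rw [← Real.exp_add, ← Real.exp_add]; norm_num
    have := Real.exp_one_gt_d9
    rw [h1]
    nlinarith
  have hexp1 : Real.exp 1 ≤ 6 := by linarith [Real.exp_one_lt_d9]
  have hE := integral_six_zpow_plateau_le hX hp hr (60 * l) M 0
  have hA : ∏ i ∈ Finset.range M, (1 - r i / 2) ≤ Real.exp (-(15 * l)) := by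
    calc ∏ i ∈ Finset.range M, (1 - r i / 2) ≤ ∏ i ∈ Finset.range M, Real.exp (-(r i / 2)) :=
          Finset.prod_le_prod (fun i _ => by linarith [(hr i).2]) fun i _ => by
            linarith [Real.add_one_le_exp (-(r i / 2))]
      _ = Real.exp (∑ i ∈ Finset.range M, -(r i / 2)) := (Real.exp_sum _ _).symm
      _ ≤ _ := by
          rw [Real.exp_le_exp, Finset.sum_neg_distrib, ← Finset.sum_div]
          linarith
  have hB : ∏ i ∈ Finset.range M, (1 + r i / 4) ≤ Real.exp (15 * l) := by
    calc ∏ i ∈ Finset.range M, (1 + r i / 4) ≤ ∏ i ∈ Finset.range M, Real.exp (r i / 4) :=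
          Finset.prod_le_prod (fun i _ => by linarith [(hr i).1]) fun i _ => by
            linarith [Real.add_one_le_exp (r i / 4)]
      _ = Real.exp (∑ i ∈ Finset.range M, r i / 4) := (Real.exp_sum _ _).symm
      _ ≤ _ := by
          rw [Real.exp_le_exp, ← Finset.sum_div]
          linarith
  have hR : (6 : ℝ) ^ (-((60 * l : ℕ) : ℤ)) ≤ Real.exp (-(60 * l)) := by
    rw [zpow_neg, zpow_natCast, Real.exp_neg]
    refine inv_anti₀ (Real.exp_pos _) ?_
    have : Real.exp (60 * l) = Real.exp 1 ^ (60 * l) := by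
      rw [← Real.exp_nat_mul]; push_cast; ring_nf
    rw [this]
    exact pow_le_pow_left₀ (Real.exp_pos _).le hexp1 _
  have hE' : ∫ ω, (6 : ℝ) ^ (-gridHeight (fun z => X z ω) (plateau (60 * l)) M 0) ∂μ ≤
      3 * Real.exp (-(15 * l)) := by
    refine hE.trans ?_
    have : (6 : ℝ) ^ (-((60 * l : ℕ) : ℤ)) * ∏ i ∈ Finset.range M, (1 + r i / 4) ≤
        Real.exp (-(15 * l)) := by
      refine (mul_le_mul hR hB (Finset.prod_nonneg fun i _ => by linarith [(hr i).1])
        (Real.exp_pos _).le).trans ?_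
      rw [← Real.exp_add, Real.exp_le_exp]
      linarith
    simp only [zpow_zero, neg_zero]
    linarith
  have hM := mul_meas_ge_le_integral_of_nonneg (μ := μ)
    (f := fun ω => (6 : ℝ) ^ (-gridHeight (fun z => X z ω) (plateau (60 * l)) M 0))
    (Eventually.of_forall fun ω => by positivity)
    (hX.integrable (dependsOn_six_zpow _ M 0)) ((6 : ℝ) ^ (-(5 * l : ℤ)))
  have hsub : {ω | gridHeight (fun z => X z ω) (plateau (60 * l)) M 0 < 5 * l} ⊆
      {ω | (6 : ℝ) ^ (-(5 * l : ℤ)) ≤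
        (6 : ℝ) ^ (-gridHeight (fun z => X z ω) (plateau (60 * l)) M 0)} := by
    intro ω hω
    simp only [Set.mem_ofPred_eq] at hω ⊢
    exact zpow_le_zpow_right₀ (by norm_num) (by omega)
  have h6 : Real.exp (-(10 * l)) ≤ (6 : ℝ) ^ (-(5 * l : ℤ)) := by
    rw [zpow_neg, Real.exp_neg]
    refine inv_anti₀ (by positivity) ?_
    have : Real.exp (10 * l) = Real.exp 2 ^ (5 * l) := by
      rw [← Real.exp_nat_mul]; push_cast; ring_nf
    rw [this]
    have e : ((6 : ℝ) ^ (5 * l : ℤ)) = 6 ^ (5 * l) := by exact_mod_cast zpow_natCast (6 : ℝ) (5 * l)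
    rw [e]
    exact pow_le_pow_left₀ (by norm_num) hexp2 _
  have hmono := measureReal_mono (μ := μ) hsub
  set P := μ.real {ω | gridHeight (fun z => X z ω) (plateau (60 * l)) M 0 < 5 * l}
  have hP0 : 0 ≤ P := measureReal_nonneg
  have h3 : Real.exp (-(10 * l)) * P ≤ 3 * Real.exp (-(15 * l)) := by
    refine le_trans ?_ (hM.trans hE')
    exact mul_le_mul h6 hmono hP0 (by positivity)
  have h4 : Real.exp (-(15 * l)) = Real.exp (-(10 * l)) * Real.exp (-(5 * l)) := by
    rw [← Real.exp_add]; ring_nf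
  have h5 : Real.exp (-(5 * l)) ≤ 1 / 90 := by
    rw [Real.exp_neg, ← one_div]
    refine one_div_le_one_div_of_le (by norm_num) (hexp5.trans ?_)
    rw [Real.exp_le_exp]; linarith
  have h7 := Real.exp_pos (-(10 * l : ℝ))
  rw [h4] at h3
  have : P ≤ 3 * Real.exp (-(5 * l)) := by
    refine le_of_mul_le_mul_left ?_ h7
    linarith
  linarith

/-- Control at the multiples of `l` and the Lipschitz property put `G` above the plateau at level
`⌈m⌉ - 2 l`. The plateau then rises by `5 l`, to at least `⌈m⌉ + 3 l`, while `G 0` was at most `⌈m⌉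
+ l`. -/
theorem gridHeight_plateau_add_le {ξ : ℕ × ℤ → Bool} {G : ℤ → ℤ} (hG : IsGentle G) {m : ℝ} {l : ℕ}
    (hl : 1 ≤ l) (hm : ∀ i : ℤ, |i| ≤ 60 → |(G (i * l) : ℝ) - m| < l) {M : ℕ}
    (hH : 5 * (l : ℤ) ≤ gridHeight ξ (plateau (60 * l)) M 0) :
    G 0 + 2 * l ≤ gridHeight ξ G M 0 := by
  have hm' : ∀ i : ℤ, |i| ≤ 60 → ⌈m⌉ ≤ G (i * l) + l := by
    intro i hi
    have := (abs_lt.1 (hm i hi)).1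
    rw [Int.ceil_le]
    push_cast
    linarith
  have hup : G 0 ≤ ⌈m⌉ + l := by
    have h1 := (abs_lt.1 (hm 0 (by simp))).2
    rw [zero_mul] at h1
    have h2 := Int.le_ceil m
    have : (G 0 : ℝ) ≤ ((⌈m⌉ + l : ℤ) : ℝ) := by push_cast; linarith
    exact_mod_cast this
  have hb : ∀ x, plateau (60 * l) x + (⌈m⌉ - 2 * l) ≤ G x := by
    intro x
    unfold plateau
    push_cast
    have hl0 : (0 : ℤ) < l := by exact_mod_cast hl
    rcases le_or_gt |x| (60 * l) with hx | hx
    · rw [abs_le] at hx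
      have h1 := Int.ediv_mul_le x hl0.ne'
      have h2 := Int.lt_ediv_add_one_mul_self x hl0
      have h3 : |x / l| ≤ 60 := by
        rw [abs_le]
        constructor
        · rw [Int.le_ediv_iff_mul_le hl0]; linarith
        · exact Int.lt_add_one_iff.1 ((Int.ediv_lt_iff_lt_mul hl0).2 (by linarith))
      have h4 := hm' _ h3
      have h5 := hG.le_add_abs (x / l * l) x
      rw [abs_of_nonpos (by linarith)] at h5
      have : 0 ≤ max (|x| - 60 * l) 0 := le_max_right _ _
      linarith
    · rw [max_eq_left (by linarith)]
      rcases abs_cases x with ⟨h1, h2⟩ | ⟨h1, h2⟩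
      · have h4 := hm' 60 (by norm_num)
        have h5 := hG.le_add_abs (60 * l) x
        rw [abs_of_nonpos (by linarith)] at h5
        linarith
      · have h4 := hm' (-60) (by norm_num)
        have h5 := hG.le_add_abs (-60 * l) x
        rw [abs_of_nonneg (by linarith)] at h5
        linarith
  have h1 := gridHeight_mono_left (ξ := ξ) hb M 0
  rw [gridHeight_add_const] at h1
  linarith

theorem dependsOn_gridHeight_cast (h : ℤ → ℤ) (j : ℕ) (x : ℤ) :
    DependsOn (fun ξ => (gridHeight ξ h j x : ℝ))
      ((Finset.range j ×ˢ Finset.Icc (x - j) (x + j) : Finset (ℕ × ℤ)) : Set (ℕ × ℤ)) :=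
  (dependsOn_gridHeight h j x).comp_left fun a => (a : ℝ)

theorem gridHeight_zero_eq_translate (ξ : ℕ × ℤ → Bool) (j : ℕ) (x : ℤ) :
    gridHeight ξ (fun _ => 0) j x =
      gridHeight (fun z => ξ (z.1, z.2 + x)) (fun _ => 0) j 0 := by
  have := gridHeight_translate (ξ := ξ) (h := fun _ => 0) x j 0
  rw [zero_add] at this
  exact this.symm

theorem IsCoins.translate (hX : IsCoins μ X p) (hp : ∀ z, p z = r z.1) (x : ℤ) :
    IsCoins μ (fun z : ℕ × ℤ => X (z.1, z.2 + x)) p := by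
  have h := hX.precomp (g := fun z : ℕ × ℤ => (z.1, z.2 + x)) fun a b hab => by
    rw [Prod.mk.injEq] at hab
    exact Prod.ext hab.1 (add_right_cancel hab.2)
  have e : (fun z : ℕ × ℤ => p (z.1, z.2 + x)) = p := funext fun z => by rw [hp, hp]
  rwa [e] at h

theorem integral_gridHeight_translate (hX : IsCoins μ X p) (hp : ∀ z, p z = r z.1) (j : ℕ)
    (x : ℤ) :
    ∫ ω, (gridHeight (fun z => X z ω) (fun _ => 0) j x : ℝ) ∂μ =
      ∫ ω, (gridHeight (fun z => X z ω) (fun _ => 0) j 0 : ℝ) ∂μ := by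
  simp_rw [gridHeight_zero_eq_translate _ j x]
  exact (hX.translate hp x).integral_congr hX (dependsOn_gridHeight_cast _ j 0)

theorem variance_gridHeight_translate (hX : IsCoins μ X p) (hp : ∀ z, p z = r z.1) (j : ℕ)
    (x : ℤ) :
    Var[fun ω => (gridHeight (fun z => X z ω) (fun _ => 0) j x : ℝ); μ] =
      Var[fun ω => (gridHeight (fun z => X z ω) (fun _ => 0) j 0 : ℝ); μ] := by
  have e : (fun ω => (gridHeight (fun z => X z ω) (fun _ => 0) j x : ℝ)) = fun ω =>
      (gridHeight (fun z => X (z.1, z.2 + x) ω) (fun _ => 0) j 0 : ℝ) :=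
    funext fun ω => by rw [gridHeight_zero_eq_translate]
  rw [e]
  exact IsCoins.variance_congr (φ := fun ξ => (gridHeight ξ (fun _ => 0) j 0 : ℝ))
    (hX.translate hp x) hX (dependsOn_gridHeight_cast _ j 0)

/-- If the height fluctuates by much less than `l`, the surface is flat enough to gain at least `l`
during an additional time of order `l`. -/
theorem le_integral_gridHeight_sub (hX : IsCoins μ X p) (hp : ∀ z, p z = r z.1)
    (hr : ∀ j, 0 ≤ r j ∧ r j ≤ 1) {l : ℕ} (hl : 1 ≤ l) {K M : ℕ}
    (h₁ : 30 * (l : ℝ) ≤ ∑ j ∈ Finset.range M, r (K + j))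
    (h₂ : ∑ j ∈ Finset.range M, r (K + j) ≤ 60 * (l : ℝ))
    (hvar : Var[fun ω => (gridHeight (fun z => X z ω) (fun _ => 0) K 0 : ℝ); μ] ≤
      (l : ℝ) ^ 2 / 1000) :
    (l : ℝ) ≤ ∫ ω, (gridHeight (fun z => X z ω) (fun _ => 0) (K + M) 0 : ℝ) ∂μ -
      ∫ ω, (gridHeight (fun z => X z ω) (fun _ => 0) K 0 : ℝ) ∂μ := by
  have hl' : (1 : ℝ) ≤ l := by exact_mod_cast hl
  set m := ∫ ω, (gridHeight (fun z => X z ω) (fun _ => 0) K 0 : ℝ) ∂μ with hm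
  have hX' : IsCoins μ (fun z : ℕ × ℤ => X (K + z.1, z.2)) (fun z => r (K + z.1)) := by
    have h := hX.precomp (g := fun z : ℕ × ℤ => (K + z.1, z.2)) fun a b hab => by
      rw [Prod.mk.injEq] at hab
      exact Prod.ext (add_left_cancel hab.1) hab.2
    have e : (fun z : ℕ × ℤ => p (K + z.1, z.2)) = fun z => r (K + z.1) :=
      funext fun z => by rw [hp]
    rwa [e] at h
  set H : Ω → ℤ := fun ω => gridHeight (fun z => X (K + z.1, z.2) ω) (plateau (60 * l)) M 0 with hH
  set E : Set Ω := {ω | H ω < 5 * l} with hE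
  have hPE : μ.real E ≤ 1 / 30 := prob_plateau_lt_le (r := fun j => r (K + j)) hX'
    (fun z => rfl) (fun j => hr _) hl h₁ h₂
  set F : ℤ → Set Ω := fun i =>
    {ω | (l : ℝ) ≤ |(gridHeight (fun z => X z ω) (fun _ => 0) K (i * l) : ℝ) - m|} with hF
  have hmem : ∀ j x, MemLp (fun ω => (gridHeight (fun z => X z ω) (fun _ => 0) j x : ℝ)) 2 μ :=
    fun j x => hX.memLp (dependsOn_gridHeight_cast _ j x) 2
  have hint : ∀ j x, Integrable (fun ω => (gridHeight (fun z => X z ω) (fun _ => 0) j x : ℝ)) μ :=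
    fun j x => hX.integrable (dependsOn_gridHeight_cast _ j x)
  have hPF : ∀ i, μ.real (F i) ≤ 1 / 1000 := by
    intro i
    have h := meas_ge_le_variance_div_sq (hmem K (i * l)) (c := l) (by linarith)
    rw [variance_gridHeight_translate hX hp, integral_gridHeight_translate hX hp, ← hm] at h
    have h' := ENNReal.toReal_mono ENNReal.ofReal_ne_top h
    rw [ENNReal.toReal_ofReal (div_nonneg (variance_nonneg _ _) (sq_nonneg _))] at h'
    refine h'.trans ?_
    rw [div_le_iff₀ (by positivity)]
    linarith
  set B : Set Ω := E ∪ ⋃ i ∈ Finset.Icc (-60 : ℤ) 60, F i with hB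
  -- A union bound with 121 sites: `1/30 + 121/1000 < 1/2`. Off `B` the gain is at least `2 l`, and
  -- it is never negative, so its mean is at least `l`.
  have hPB : μ.real B ≤ 1 / 2 := by
    have h1 : μ.real (⋃ i ∈ Finset.Icc (-60 : ℤ) 60, F i) ≤ 121 / 1000 := by
      refine (measureReal_biUnion_finset_le _ _).trans ?_
      refine (Finset.sum_le_sum fun i _ => hPF i).trans ?_
      rw [Finset.sum_const, Int.card_Icc, show ((60 : ℤ) + 1 - -60).toNat = 121 from rfl]
      norm_num
    have := measureReal_union_le (μ := μ) E (⋃ i ∈ Finset.Icc (-60 : ℤ) 60, F i)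
    linarith
  have hEm : MeasurableSet E := by
    have h := hX'.measurable_comp (dependsOn_gridHeight_cast (plateau (60 * l)) M 0)
    have e : E = {ω | (H ω : ℝ) < ((5 * l : ℤ) : ℝ)} := by
      ext ω
      exact (Int.cast_lt (R := ℝ)).symm
    rw [e]
    exact measurableSet_lt h measurable_const
  have hBm : MeasurableSet B := by
    refine hEm.union (Finset.measurableSet_biUnion _ fun i _ => ?_)
    have h := hX.measurable_comp (dependsOn_gridHeight_cast (fun _ => 0) K (i * l))
    exact measurableSet_le measurable_const (continuous_abs.measurable.comp (h.sub_const m))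
  have key : ∀ ω, Bᶜ.indicator (fun _ => 2 * (l : ℝ)) ω ≤
      (gridHeight (fun z => X z ω) (fun _ => 0) (K + M) 0 : ℝ) -
        (gridHeight (fun z => X z ω) (fun _ => 0) K 0 : ℝ) := by
    intro ω
    by_cases hω : ω ∈ B
    · rw [Set.indicator_of_notMem (by simpa using hω), sub_nonneg]
      exact_mod_cast monotone_gridHeight isGentle_zero _ 0 (Nat.le_add_right K M)
    · rw [Set.indicator_of_mem (by simpa using hω), gridHeight_add_steps]
      simp only [hB, hE, hF, Set.mem_union, Set.mem_iUnion, Finset.mem_Icc, Set.mem_ofPred_eq,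
        not_or, not_exists, not_lt, not_le] at hω
      have := gridHeight_plateau_add_le (ξ := fun z => X (K + z.1, z.2) ω)
        (isGentle_gridHeight isGentle_zero (fun z => X z ω) K) (m := m) hl
        (fun i hi => hω.2 i (abs_le.1 hi)) hω.1
      have : (((gridHeight (fun z => X z ω) (fun _ => 0) K 0 + 2 * l : ℤ)) : ℝ) ≤ _ :=
        Int.cast_le.2 this
      push_cast at this
      linarith
  have h := integral_mono ((integrable_const (μ := μ) (2 * (l : ℝ))).indicator hBm.compl)
    ((hint (K + M) 0).sub (hint K 0)) key
  rw [integral_indicator_const _ hBm.compl, probReal_compl_eq_one_sub hBm, smul_eq_mul] at h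
  simp only [Pi.sub_apply] at h
  rw [integral_sub (hint (K + M) 0) (hint K 0)] at h
  nlinarith

end Growth

/-! ### Finite speed of influence -/

section Truncation

variable {Ω : Type*} [MeasurableSpace Ω] {μ : Measure Ω} [IsProbabilityMeasure μ]
  {X : (ℕ × ℤ) × Bool → Ω → Bool} {p : (ℕ × ℤ) × Bool → ℝ}

/-- Each cell shows `true` if its first coin does, or if its second coin does and the cell belongs
to the mask. -/
def maskedCoins (mask : ℕ × ℤ → Bool) (ξ : (ℕ × ℤ) × Bool → Bool) (z : ℕ × ℤ) : Bool :=
  ξ (z, false) || (mask z && ξ (z, true))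

/-- The difference of the heights with all second coins and with the masked ones. -/
def maskDiff (mask : ℕ × ℤ → Bool) (j : ℕ) (x : ℤ) (ξ : (ℕ × ℤ) × Bool → Bool) : ℝ :=
  ((|gridHeight (maskedCoins (fun _ => true) ξ) (fun _ => 0) j x -
    gridHeight (maskedCoins mask ξ) (fun _ => 0) j x| : ℤ) : ℝ)

theorem dependsOn_maskDiff (mask : ℕ × ℤ → Bool) (j : ℕ) (x : ℤ) :
    DependsOn (maskDiff mask j x)
      (((Finset.range j ×ˢ Finset.Icc (x - j) (x + j)) ×ˢ Finset.univ :
        Finset ((ℕ × ℤ) × Bool)) : Set ((ℕ × ℤ) × Bool)) := by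
  intro ξ ξ' h
  have e : ∀ m : ℕ × ℤ → Bool, gridHeight (maskedCoins m ξ) (fun _ => 0) j x =
      gridHeight (maskedCoins m ξ') (fun _ => 0) j x := fun m => gridHeight_congr fun z hz => by
    unfold maskedCoins
    rw [h (z, false) (by simpa using hz), h (z, true) (by simpa using hz)]
  unfold maskDiff
  rw [e, e]

theorem maskDiff_succ_le (mask : ℕ × ℤ → Bool) (j : ℕ) (x : ℤ) (ξ : (ℕ × ℤ) × Bool → Bool) :
    maskDiff mask (j + 1) x ξ ≤ maskDiff mask j x ξ +
      ((if ξ ((j, x), false) then 1 else 0) * maskDiff mask j (x - 1) ξ +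
       (if ξ ((j, x), true) then 1 else 0) * maskDiff mask j (x - 1) ξ +
       (if ξ ((j, x), false) then 1 else 0) * maskDiff mask j (x + 1) ξ +
       (if ξ ((j, x), true) then 1 else 0) * maskDiff mask j (x + 1) ξ) +
      if ξ ((j, x), true) then (if mask (j, x) then 0 else 1) else 0 := by
  have h := abs_gridHeight_sub_succ_le (ξ' := maskedCoins (fun _ => true) ξ)
    (ξ := maskedCoins mask ξ) isGentle_zero j x
  have h' : maskDiff mask (j + 1) x ξ ≤ _ := Int.cast_le.2 h
  push_cast at h'
  have e : ∀ y, maskDiff mask j y ξ = |(gridHeight (maskedCoins (fun _ => true) ξ) (fun _ => 0) j y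
    : ℝ) - (gridHeight (maskedCoins mask ξ) (fun _ => 0) j y : ℝ)| := fun y => by
      simp [maskDiff]
  rw [← e, ← e, ← e] at h'
  have n1 : 0 ≤ maskDiff mask j (x - 1) ξ := e _ ▸ abs_nonneg _
  have n2 : 0 ≤ maskDiff mask j (x + 1) ξ := e _ ▸ abs_nonneg _
  refine h'.trans ?_
  unfold maskedCoins
  cases ξ ((j, x), false) <;> cases ξ ((j, x), true) <;> cases mask (j, x) <;> simp <;> linarith

/-- Averages the pointwise recursion; the coins of layer `j` are independent of the differences
after `j` steps. -/
theorem integral_maskDiff_succ_le (hX : IsCoins μ X p) (mask : ℕ × ℤ → Bool) (j : ℕ) (x : ℤ) :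
    ∫ ω, maskDiff mask (j + 1) x (fun i => X i ω) ∂μ ≤
      ∫ ω, maskDiff mask j x (fun i => X i ω) ∂μ +
        (p ((j, x), false) + p ((j, x), true)) *
          (∫ ω, maskDiff mask j (x - 1) (fun i => X i ω) ∂μ +
            ∫ ω, maskDiff mask j (x + 1) (fun i => X i ω) ∂μ) +
        if mask (j, x) then 0 else p ((j, x), true) := by
  have hI : ∀ j y, Integrable (fun ω => maskDiff mask j y fun i => X i ω) μ :=
    fun j y => hX.integrable (dependsOn_maskDiff mask j y)
  have hcI : ∀ b (c d : ℝ), Integrable (fun ω => if X ((j, x), b) ω then c else d) μ :=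
    fun b c d => hX.integrable (dependsOn_coin ((j, x), b) c d)
  have hC : ∀ b y, ∫ ω, (if X ((j, x), b) ω then 1 else 0) *
      maskDiff mask j y (fun i => X i ω) ∂μ =
        p ((j, x), b) * ∫ ω, maskDiff mask j y (fun i => X i ω) ∂μ := fun b y => by
    rw [hX.integral_coin_mul (dependsOn_maskDiff mask j y) (by simp)]
    simp
  have hCI : ∀ b y, Integrable (fun ω => (if X ((j, x), b) ω then (1 : ℝ) else 0) *
      maskDiff mask j y (fun i => X i ω)) μ := fun b y =>
    (hI j y).bdd_mul (c := 1) (hcI b 1 0).aestronglyMeasurable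
      (Eventually.of_forall fun ω => by split_ifs <;> simp)
  have hS := (((hCI false (x - 1)).add (hCI true (x - 1))).add (hCI false (x + 1))).add
    (hCI true (x + 1))
  refine (integral_mono (hI (j + 1) x) (((hI j x).add hS).add (hcI true _ _))
    fun ω => maskDiff_succ_le mask j x fun i => X i ω).trans (le_of_eq ?_)
  rw [integral_add' ((hI j x).add hS) (hcI true _ _), integral_add' (hI j x) hS,
    integral_add' (((hCI false (x - 1)).add (hCI true (x - 1))).add (hCI false (x + 1)))
      (hCI true (x + 1)),
    integral_add' ((hCI false (x - 1)).add (hCI true (x - 1))) (hCI false (x + 1)),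
    integral_add' (hCI false (x - 1)) (hCI true (x - 1)), hC, hC, hC, hC, hX.integral_coin]
  split_ifs <;> ring

/-- Masked coins far away have little influence. -/
theorem integral_maskDiff_le (hX : IsCoins μ X p) {mask : ℕ × ℤ → Bool} {Δ : ℕ → ℝ} {β : ℝ}
    {K : ℕ} (hβ : 0 ≤ β) (hp : ∀ i, 0 ≤ p i)
    (hΔ : ∀ z, p (z, false) + p (z, true) ≤ Δ z.1)
    (hmask : ∀ j x, j < K → mask (j, x) = false →
      1 ≤ β * (∏ i ∈ Finset.range (j + 1), (1 + 4 * Δ i)) * Real.cosh x) {j : ℕ} (hj : j ≤ K)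
    (x : ℤ) :
    ∫ ω, maskDiff mask j x (fun i => X i ω) ∂μ ≤
      β * (∑ i ∈ Finset.range j, Δ i) * (∏ i ∈ Finset.range j, (1 + 4 * Δ i)) * Real.cosh x := by
  have hΔ0 : ∀ i, 0 ≤ Δ i := fun i =>
    (add_nonneg (hp _) (hp _)).trans (hΔ (i, 0))
  induction j generalizing x with
  | zero => simp [maskDiff, gridHeight]
  | succ j ih =>
    refine (integral_maskDiff_succ_le hX mask j x).trans ?_
    rw [Finset.sum_range_succ]
    set s := ∑ i ∈ Finset.range j, Δ i
    have hs : 0 ≤ s := Finset.sum_nonneg fun i _ => hΔ0 i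
    have i1 := ih (by omega) (x - 1)
    have i2 := ih (by omega) x
    have i3 := ih (by omega) (x + 1)
    have hm := hmask j x (by omega)
    rw [Finset.prod_range_succ] at hm ⊢
    set P := ∏ i ∈ Finset.range j, (1 + 4 * Δ i)
    have hP : 0 ≤ P := Finset.prod_nonneg fun i _ => by linarith [hΔ0 i]
    have hcosh1 : Real.cosh 1 ≤ 2 := by
      rw [Real.cosh_eq]
      have h1 := Real.exp_one_lt_d9
      have h2 : Real.exp (-1) ≤ 1 := by rw [Real.exp_le_one_iff]; norm_num
      linarith
    have hc := Real.cosh_pos (x : ℝ)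
    -- The sum is `2 cosh 1 cosh x`. So `cosh` grows by at most `1 + 4 Δ j` per step and can serve
    -- as a barrier.
    have hsum : Real.cosh ((x - 1 : ℤ) : ℝ) + Real.cosh ((x + 1 : ℤ) : ℝ) ≤ 4 * Real.cosh x := by
      push_cast
      rw [Real.cosh_sub, Real.cosh_add]
      nlinarith
    have hd := hΔ (j, x)
    have hd0 := hΔ0 j
    have hp0 := hp ((j, x), false)
    have hp1 := hp ((j, x), true)
    have hbsP : 0 ≤ β * s * P := by positivity
    have k1 : (p ((j, x), false) + p ((j, x), true)) *
          (∫ ω, maskDiff mask j (x - 1) (fun i => X i ω) ∂μ +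
            ∫ ω, maskDiff mask j (x + 1) (fun i => X i ω) ∂μ) ≤
        Δ j * (β * s * P * (4 * Real.cosh x)) := by
      refine (mul_le_mul_of_nonneg_left (add_le_add i1 i3) (by linarith)).trans ?_
      rw [← mul_add]
      exact mul_le_mul hd (mul_le_mul_of_nonneg_left hsum hbsP)
        (mul_nonneg hbsP (add_nonneg (Real.cosh_pos _).le (Real.cosh_pos _).le)) hd0
    -- New differences arise only at cells outside the mask, where `hmask` makes the barrier at
    -- least one.
    have k2 : (if mask (j, x) then 0 else p ((j, x), true)) ≤
        Δ j * (β * (P * (1 + 4 * Δ j)) * Real.cosh x) := by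
      have : 0 ≤ β * (P * (1 + 4 * Δ j)) * Real.cosh x := by positivity
      cases h : mask (j, x)
      · simp only [Bool.false_eq_true, if_false]
        have := mul_le_mul_of_nonneg_left (hm h) hd0
        simp only at hd
        linarith
      · simp only [if_true]
        positivity
    have : β * (s + Δ j) * (P * (1 + 4 * Δ j)) * Real.cosh x =
        β * s * P * Real.cosh x + Δ j * (β * s * P * (4 * Real.cosh x)) +
          Δ j * (β * (P * (1 + 4 * Δ j)) * Real.cosh x) := by ring
    linarith

end Truncation

/-! ### Grid growth and RSOS evolution for fixed clocks: uniqueness and existence -/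

open Classical in
/-- The coins that record which cells of the time grid `s` contain a ring. -/
noncomputable def clockCoins (U : ℤ → Set ℝ) (s : ℕ → ℝ) (z : ℕ × ℤ) : Bool :=
  decide (U z.2 ∩ Ioc (s z.1) (s (z.1 + 1))).Nonempty

theorem clockCoins_eq_true {U : ℤ → Set ℝ} {s : ℕ → ℝ} {z : ℕ × ℤ} :
    clockCoins U s z = true ↔ (U z.2 ∩ Ioc (s z.1) (s (z.1 + 1))).Nonempty := by
  simp [clockCoins]

theorem clockCoins_eq_false {U : ℤ → Set ℝ} {s : ℕ → ℝ} {z : ℕ × ℤ} :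
    clockCoins U s z = false ↔ Disjoint (U z.2) (Ioc (s z.1) (s (z.1 + 1))) := by
  rw [Set.disjoint_iff_inter_eq_empty, ← Set.not_nonempty_iff_eq_empty, ← clockCoins_eq_true]
  simp

/-- The evolution rules on the sites of `[l, r]` up to time `N`, with no rule for rings at the two
boundary sites. -/
structure IsLocalEvolution (U : ℤ → Set ℝ) (l r : ℤ) (N : ℝ) (f : ℝ → ℤ → ℤ) : Prop where
  init : ∀ x ∈ Icc l r, f 0 x = 0
  ring : ∀ t x, 0 < t → t ≤ N → x ∈ Ioo l r → t ∈ U x →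
    ∀ᶠ s in 𝓝[<] t, f t x = rsosUpdate (f s) x
  const : ∀ s t x, 0 ≤ s → s ≤ t → t ≤ N → x ∈ Icc l r → Disjoint (U x) (Ioc s t) → f t x = f s x

theorem IsLocalEvolution.mono {U : ℤ → Set ℝ} {l r l' r' : ℤ} {N N' : ℝ} {f : ℝ → ℤ → ℤ}
    (hf : IsLocalEvolution U l r N f) (hl : l ≤ l') (hr : r' ≤ r) (hN : N' ≤ N) :
    IsLocalEvolution U l' r' N' f where
  init x hx := hf.init x ⟨hl.trans hx.1, hx.2.trans hr⟩
  ring t x h0 h1 hx := hf.ring t x h0 (h1.trans hN) ⟨hl.trans_lt hx.1, hx.2.trans_le hr⟩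
  const s t x h0 h1 h2 hx := hf.const s t x h0 h1 (h2.trans hN) ⟨hl.trans hx.1, hx.2.trans hr⟩

theorem IsRSOSEvolution.isLocalEvolution {U : ℤ → Set ℝ} {f : ℝ → ℤ → ℤ}
    (hf : IsRSOSEvolution U (fun _ => 0) f) (l r : ℤ) (N : ℝ) : IsLocalEvolution U l r N f where
  init x _ := hf.init x
  ring t x h0 _ _ := hf.ring t x h0
  const s t x h0 h1 _ _ := hf.const s t x h0 h1

/-- No clock at a boundary site of `[l, r]` rings up to time `N`. -/
def IsIsland (U : ℤ → Set ℝ) (l r : ℤ) (N : ℝ) : Prop :=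
  Disjoint (U l) (Ioc 0 N) ∧ Disjoint (U r) (Ioc 0 N)

theorem IsIsland.inter {U : ℤ → Set ℝ} {l r l' r' : ℤ} {N N' : ℝ} (h : IsIsland U l r N)
    (h' : IsIsland U l' r' N') : IsIsland U (max l l') (min r r') (min N N') := by
  have e : Ioc 0 (min N N') ⊆ Ioc 0 N := Ioc_subset_Ioc_right (min_le_left _ _)
  have e' : Ioc 0 (min N N') ⊆ Ioc 0 N' := Ioc_subset_Ioc_right (min_le_right _ _)
  constructor
  · rcases max_choice l l' with hc | hc <;> rw [hc]
    · exact h.1.mono_right e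
    · exact h'.1.mono_right e'
  · rcases min_choice r r' with hc | hc <;> rw [hc]
    · exact h.2.mono_right e
    · exact h'.2.mono_right e'

/-- Within an island each time layer contains at most one ring time, so the heights just before a
ring are those at the start of the layer. Simultaneous rings at different sites do no harm: both
dynamics apply the rule to the heights before the ring. -/
theorem IsLocalEvolution.gridHeight_eq {U : ℤ → Set ℝ} {l r : ℤ} {N : ℝ} {f : ℝ → ℤ → ℤ}
    (hf : IsLocalEvolution U l r N f) (hi : IsIsland U l r N) {s : ℕ → ℝ} (hs : Monotone s)
    (hs0 : s 0 = 0) {K : ℕ} (hK : s K ≤ N)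
    (hsep : ∀ j < K, ∀ x ∈ Ioo l r, ∀ y ∈ Ioo l r, ∀ a ∈ U x ∩ Ioc (s j) (s (j + 1)),
      ∀ b ∈ U y ∩ Ioc (s j) (s (j + 1)), a = b) {j : ℕ} (hj : j ≤ K) {x : ℤ}
    (hx : x ∈ Icc l r) : gridHeight (clockCoins U s) (fun _ => 0) j x = f (s j) x := by
  induction j generalizing x with
  | zero => rw [hs0, hf.init x hx]; rfl
  | succ j ih =>
    have ih' : ∀ y ∈ Icc l r, gridHeight (clockCoins U s) (fun _ => 0) j y = f (s j) y :=
      fun y hy => ih (by omega) hy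
    have hsj : 0 ≤ s j := hs0 ▸ hs (Nat.zero_le j)
    have hsj' : s j ≤ s (j + 1) := hs (Nat.le_succ j)
    have hsN : s (j + 1) ≤ N := (hs hj).trans hK
    have hsub : Ioc (s j) (s (j + 1)) ⊆ Ioc 0 N := Ioc_subset_Ioc hsj hsN
    rw [gridHeight_succ]
    cases hc : clockCoins U s (j, x) with
    | false =>
      rw [if_neg (by simp), ih' x hx,
        hf.const _ _ x hsj hsj' hsN hx (clockCoins_eq_false.1 hc)]
    | true =>
      rw [if_pos rfl]
      obtain ⟨τ, hτU, hτ⟩ := clockCoins_eq_true.1 hc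
      simp only at hτU hτ
      have hx' : x ∈ Ioo l r := by
        refine ⟨lt_of_le_of_ne hx.1 ?_, lt_of_le_of_ne hx.2 ?_⟩
        · rintro rfl; exact Set.disjoint_left.1 hi.1 hτU (hsub hτ)
        · rintro rfl; exact Set.disjoint_left.1 hi.2 hτU (hsub hτ)
      have hev := (hf.ring τ x (hsub hτ).1 (hsub hτ).2 hx' hτU).and (Ioo_mem_nhdsLT hτ.1)
      obtain ⟨u, hu, hu1, hu2⟩ := hev.exists
      have hfu : ∀ y ∈ Icc l r, f u y = gridHeight (clockCoins U s) (fun _ => 0) j y := by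
        intro y hy
        rw [ih' y hy]
        refine hf.const _ _ y hsj hu1.le (hu2.le.trans (hsub hτ).2) hy ?_
        rw [Set.disjoint_left]
        intro w hw hwI
        have hwI' : w ∈ Ioc (s j) (s (j + 1)) := ⟨hwI.1, hwI.2.trans (hu2.le.trans hτ.2)⟩
        rcases eq_or_lt_of_le hy.1 with rfl | h1
        · exact Set.disjoint_left.1 hi.1 hw (hsub hwI')
        rcases eq_or_lt_of_le hy.2 with rfl | h2
        · exact Set.disjoint_left.1 hi.2 hw (hsub hwI')
        have := hsep j (by omega) y ⟨h1, h2⟩ x hx' w ⟨hw, hwI'⟩ τ ⟨hτU, hτ⟩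
        linarith [hwI.2]
      have e0 := hfu x hx
      have e1 := hfu (x - 1) ⟨by have := hx'.1; omega, by have := hx'.2; omega⟩
      have e2 := hfu (x + 1) ⟨by have := hx'.1; omega, by have := hx'.2; omega⟩
      have hg := isGentle_gridHeight isGentle_zero (clockCoins U s) j
      have g1 := hg (x - 1)
      have g2 := hg x
      rw [sub_add_cancel, ← e0, ← e1] at g1
      rw [← e0, ← e2] at g2
      rw [← e0, ← e1, ← e2, ← rsosUpdate_eq_min g1 g2, ← hu]
      refine (hf.const _ _ x (hsub hτ).1.le hτ.2 hsN hx ?_).symm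
      rw [Set.disjoint_left]
      intro w hw hwI
      have := hsep j (by omega) x hx' x hx' w ⟨hw, hτ.1.trans hwI.1, hwI.2⟩ τ ⟨hτU, hτ⟩
      linarith [hwI.1]

/-- All clocks ring finitely often in bounded time, and for each time horizon there are, arbitrarily far on both sides, clocks that do not ring. -/
structure IsGoodClocks (U : ℤ → Set ℝ) : Prop where
  finite : ∀ x T, (U x ∩ Ioc 0 T).Finite
  right : ∀ N M : ℕ, ∃ x : ℤ, M < x ∧ Disjoint (U x) (Ioc 0 N)
  left : ∀ N M : ℕ, ∃ x : ℤ, x < -M ∧ Disjoint (U x) (Ioc 0 N)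

theorem Set.Finite.exists_pos_separation {S : Set ℝ} (hS : S.Finite) :
    ∃ η > 0, ∀ a ∈ S, ∀ b ∈ S, |a - b| < η → a = b := by
  have hfin : (S ×ˢ S).Finite := hS.prod hS
  have : ∀ᶠ η in 𝓝[>] (0 : ℝ), ∀ q ∈ S ×ˢ S, |q.1 - q.2| < η → q.1 = q.2 := by
    rw [Filter.eventually_all_finite hfin]
    intro q _
    by_cases h : q.1 = q.2
    · exact Eventually.of_forall fun _ _ => h
    · have hpos : 0 < |q.1 - q.2| := abs_pos.2 (sub_ne_zero.2 h)
      filter_upwards [Ioo_mem_nhdsGT hpos] with η hη hlt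
      exact absurd hlt (not_lt.2 hη.2.le)
  obtain ⟨η, h, hη⟩ := (this.and self_mem_nhdsWithin).exists
  exact ⟨η, hη, fun a ha b hb hab => h (a, b) ⟨ha, hb⟩ hab⟩

theorem IsGoodClocks.finite_biUnion {U : ℤ → Set ℝ} (hU : IsGoodClocks U) (l r : ℤ) (N : ℝ) :
    (⋃ x ∈ Ioo l r, U x ∩ Ioc 0 N).Finite :=
  (Set.finite_Ioo l r).biUnion fun x _ => hU.finite x N

/-- An island sees finitely many ring times, and any mesh below their smallest gap separates them.
The mesh is chosen before `f`, which makes the comparison usable for uniqueness. -/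
theorem IsGoodClocks.exists_mesh {U : ℤ → Set ℝ} (hU : IsGoodClocks U) {l r : ℤ} {N : ℝ}
    (hi : IsIsland U l r N) :
    ∃ η > 0, ∀ f, IsLocalEvolution U l r N f → ∀ s : ℕ → ℝ, Monotone s → s 0 = 0 →
      ∀ K, s K ≤ N → (∀ j < K, s (j + 1) - s j < η) → ∀ x ∈ Icc l r,
        gridHeight (clockCoins U s) (fun _ => 0) K x = f (s K) x := by
  obtain ⟨η, hη, h⟩ := (hU.finite_biUnion l r N).exists_pos_separation
  refine ⟨η, hη, fun f hf s hs hs0 K hK hm x hx => hf.gridHeight_eq hi hs hs0 hK ?_ le_rfl hx⟩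
  intro j hj x hx y hy a ha b hb
  have hsub : Ioc (s j) (s (j + 1)) ⊆ Ioc 0 N :=
    Ioc_subset_Ioc (hs0 ▸ hs (Nat.zero_le j)) ((hs hj).trans hK)
  refine h a (mem_biUnion hx ⟨ha.1, hsub ha.2⟩) b (mem_biUnion hy ⟨hb.1, hsub hb.2⟩) ?_
  rw [abs_lt]
  have := hm j hj
  constructor <;> linarith [ha.2.1, ha.2.2, hb.2.1, hb.2.2]

/-- Both evolutions equal the same grid growth on a fine uniform grid ending at `t`. -/
theorem IsGoodClocks.eq_of_isLocalEvolution {U : ℤ → Set ℝ} (hU : IsGoodClocks U) {l r : ℤ}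
    {N : ℝ} (hi : IsIsland U l r N) {f g : ℝ → ℤ → ℤ} (hf : IsLocalEvolution U l r N f)
    (hg : IsLocalEvolution U l r N g) {t : ℝ} (ht : 0 ≤ t) (htN : t ≤ N) {x : ℤ}
    (hx : x ∈ Icc l r) : f t x = g t x := by
  obtain ⟨η, hη, h⟩ := hU.exists_mesh hi
  obtain ⟨n, hn⟩ := exists_nat_gt (t / η)
  have hn0 : (0 : ℝ) < n := (div_nonneg ht hη.le).trans_lt hn
  have hs : Monotone fun j : ℕ => (j : ℝ) * (t / n) := fun i j hij => by
    have : (i : ℝ) ≤ j := by exact_mod_cast hij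
    exact mul_le_mul_of_nonneg_right this (by positivity)
  have hend : (n : ℝ) * (t / n) = t := by field_simp
  have hm : ∀ j < n, ((j + 1 : ℕ) : ℝ) * (t / n) - (j : ℝ) * (t / n) < η := by
    intro j _
    push_cast
    rw [div_lt_iff₀ hη] at hn
    rw [← sub_mul, add_sub_cancel_left, one_mul, div_lt_iff₀ hn0]
    linarith
  have h1 := h f hf _ hs (by simp) n (by simpa [hend] using htN) hm x hx
  have h2 := h g hg _ hs (by simp) n (by simpa [hend] using htN) hm x hx
  simp only [hend] at h1 h2
  rw [← h1, ← h2]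

theorem IsGoodClocks.eq_of_isIsland {U : ℤ → Set ℝ} (hU : IsGoodClocks U) {l r l' r' : ℤ}
    {N N' : ℝ} (hi : IsIsland U l r N) (hi' : IsIsland U l' r' N') {f g : ℝ → ℤ → ℤ}
    (hf : IsLocalEvolution U l r N f) (hg : IsLocalEvolution U l' r' N' g) {t : ℝ} (ht : 0 ≤ t)
    (htN : t ≤ N) (htN' : t ≤ N') {x : ℤ} (hx : x ∈ Icc l r) (hx' : x ∈ Icc l' r') :
    f t x = g t x :=
  hU.eq_of_isLocalEvolution (hi.inter hi')
    (hf.mono (le_max_left _ _) (min_le_left _ _) (min_le_left _ _))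
    (hg.mono (le_max_right _ _) (min_le_right _ _) (min_le_right _ _)) ht (le_min htN htN')
    ⟨max_le hx.1 hx'.1, le_min hx.2 hx'.2⟩

/-- Induction on the last ring time `τ`: run the evolution without the rings at `τ`, then update at
once all sites that ring there. -/
theorem exists_isRSOSEvolution_of_finset (S : Finset ℝ) :
    ∀ U : ℤ → Set ℝ, (∀ a ∈ S, 0 < a) → (∀ x, U x ⊆ S) →
      ∃ f, IsRSOSEvolution U (fun _ => 0) f := by
  induction S using Finset.induction_on_max with
  | empty =>
    intro U _ hU
    have hU' : ∀ x t, t ∉ U x := fun x t ht => by simpa using hU x ht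
    exact ⟨fun _ _ => 0, fun _ => rfl, fun t x _ ht => absurd ht (hU' x t), fun _ _ _ _ _ _ => rfl⟩
  | insert τ S hτ ih =>
    intro U hpos hU
    have hτ0 : 0 < τ := hpos τ (Finset.mem_insert_self _ _)
    obtain ⟨g, hg⟩ := ih (fun x => U x \ {τ})
      (fun a ha => hpos a (Finset.mem_insert_of_mem ha)) fun x t ht => by
        have := hU x ht.1
        simp only [Finset.coe_insert, Set.mem_insert_iff] at this
        exact this.resolve_left ht.2
    have hgc : ∀ s t x, 0 ≤ s → s ≤ t → Disjoint (U x) (Ioc s t) → g t x = g s x :=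
      fun s t x h0 h1 hd => hg.const s t x h0 h1 (hd.mono_left Set.sdiff_subset)
    classical
    refine ⟨fun t x => if t < τ then g t x else
      if τ ∈ U x then rsosUpdate (g τ) x else g τ x, fun x => ?_, ?_, ?_⟩
    · simp only [hτ0, if_true]
      exact hg.init x
    · intro t x ht htU
      rcases lt_trichotomy t τ with h | rfl | h
      · filter_upwards [hg.ring t x ht ⟨htU, h.ne⟩, self_mem_nhdsWithin] with s hs hst
        have hst' : s < τ := lt_trans hst h
        simp only [h, hst', if_true]
        exact hs
      · have hS : ∀ᶠ s in 𝓝[<] t, ∀ a ∈ S, a < s := by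
          rw [Filter.eventually_all_finset]
          intro a ha
          filter_upwards [Ioo_mem_nhdsLT (hτ a ha)] with s hs using hs.1
        filter_upwards [hS, Ioo_mem_nhdsLT ht] with s hs hst
        simp only [lt_irrefl, hst.2, htU, if_true, if_false]
        have : g t = g s := by
          funext y
          refine hg.const s t y hst.1.le hst.2.le ?_
          rw [Set.disjoint_left]
          intro w hw hwI
          have := hU y hw.1
          simp only [Finset.coe_insert, Set.mem_insert_iff] at this
          exact absurd (hs w (Finset.mem_coe.1 (this.resolve_left hw.2))) (not_lt.2 hwI.1.le)
        rw [this]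
      · exfalso
        have := hU x htU
        simp only [Finset.coe_insert, Set.mem_insert_iff] at this
        rcases this with rfl | h'
        · exact lt_irrefl _ h
        · exact lt_asymm h (hτ t h')
    · intro s t x hs hst hd
      rcases lt_or_ge t τ with ht | ht
      · simp only [ht, hst.trans_lt ht, if_true]
        exact hgc s t x hs hst hd
      · rcases lt_or_ge s τ with hs' | hs'
        · have hn : τ ∉ U x := fun h => Set.disjoint_left.1 hd h ⟨hs', ht⟩
          simp only [not_lt.2 ht, hs', hn, if_true, if_false]
          exact hgc s τ x hs hs'.le (hd.mono_right (Ioc_subset_Ioc_right ht))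
        · simp only [not_lt.2 ht, not_lt.2 hs', if_false]

theorem IsGoodClocks.exists_isLocalEvolution {U : ℤ → Set ℝ} (hU : IsGoodClocks U) (l r : ℤ)
    (N : ℝ) : ∃ f, IsLocalEvolution U l r N f := by
  have hfin := hU.finite_biUnion l r N
  classical
  obtain ⟨f, hf⟩ := exists_isRSOSEvolution_of_finset hfin.toFinset
    (fun x => if x ∈ Ioo l r then U x ∩ Ioc 0 N else ∅) (fun a ha => by
      simp only [Set.Finite.mem_toFinset, Set.mem_iUnion] at ha
      obtain ⟨x, _, h⟩ := ha
      exact h.2.1) fun x => by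
      rw [Set.Finite.coe_toFinset]
      split_ifs with hx
      · exact Set.subset_biUnion_of_mem (u := fun x => U x ∩ Ioc 0 N) hx
      · exact Set.empty_subset _
  refine ⟨f, fun x _ => hf.init x, fun t x h0 hN hx ht => hf.ring t x h0 ?_,
    fun s t x h0 h1 _ _ hd => hf.const s t x h0 h1 ?_⟩
  · rw [if_pos hx]
    exact ⟨ht, h0, hN⟩
  · split_ifs
    · exact hd.mono_left Set.inter_subset_left
    · exact Set.empty_disjoint _

theorem IsGoodClocks.exists_isIsland {U : ℤ → Set ℝ} (hU : IsGoodClocks U) (n : ℕ) :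
    ∃ l r : ℤ, l < -n ∧ (n : ℤ) < r ∧ IsIsland U l r n := by
  obtain ⟨r, hr, hr'⟩ := hU.right n n
  obtain ⟨l, hl, hl'⟩ := hU.left n n
  exact ⟨l, r, hl, hr, hl', hr'⟩

theorem IsGoodClocks.exists_isRSOSEvolution {U : ℤ → Set ℝ} (hU : IsGoodClocks U) :
    ∃ f, IsRSOSEvolution U (fun _ => 0) f := by
  -- Every horizon `n` has an island around `[-n, n]` with its own evolution. By uniqueness these
  -- are consistent, so `F` may read each space-time point off any sufficiently large one.
  choose l r hl hr hi using hU.exists_isIsland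
  choose f hf using fun n : ℕ => hU.exists_isLocalEvolution (l n) (r n) n
  set F : ℝ → ℤ → ℤ := fun t x => f (max ⌈t⌉₊ x.natAbs) t x with hF
  have key : ∀ (n : ℕ) (t : ℝ) (x : ℤ), 0 ≤ t → t ≤ n → x.natAbs ≤ n → F t x = f n t x := by
    intro n t x h0 h1 h2
    set m := max ⌈t⌉₊ x.natAbs with hm
    have hm1 : t ≤ m := (Nat.le_ceil t).trans (Nat.cast_le.2 (le_max_left _ _))
    have hm2 : x.natAbs ≤ m := le_max_right _ _
    have a1 := hl m
    have a2 := hr m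
    have a3 := hl n
    have a4 := hr n
    exact hU.eq_of_isIsland (hi m) (hi n) (hf m) (hf n) h0 hm1 h1 ⟨by omega, by omega⟩
      ⟨by omega, by omega⟩
  refine ⟨F, fun x => ?_, fun t x ht htU => ?_, fun s t x hs hst hd => ?_⟩
  · rw [key x.natAbs 0 x le_rfl (by positivity) (by simp)]
    exact (hf x.natAbs).init x ⟨by have := hl x.natAbs; omega, by have := hr x.natAbs; omega⟩
  -- The extra one is needed because the rule looks at the neighbours of `x`.
  · set n := max ⌈t⌉₊ (x.natAbs + 1) with hn
    have hn1 : t ≤ n := (Nat.le_ceil t).trans (Nat.cast_le.2 (le_max_left _ _))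
    have hn2 : x.natAbs + 1 ≤ n := le_max_right _ _
    have a1 := hl n
    have a2 := hr n
    filter_upwards [(hf n).ring t x ht hn1 ⟨by omega, by omega⟩ htU, Ioo_mem_nhdsLT ht] with s h hs
    have e : ∀ y : ℤ, y.natAbs ≤ n → F s y = f n s y := fun y hy =>
      key n s y hs.1.le (hs.2.le.trans hn1) hy
    rw [key n t x ht.le hn1 (by omega), h]
    unfold rsosUpdate
    rw [e x (by omega), e (x - 1) (by omega), e (x + 1) (by omega)]
  · set n := max ⌈t⌉₊ x.natAbs with hn
    have hn1 : t ≤ n := (Nat.le_ceil t).trans (Nat.cast_le.2 (le_max_left _ _))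
    have hn2 : x.natAbs ≤ n := le_max_right _ _
    have a1 := hl n
    have a2 := hr n
    rw [key n t x (hs.trans hst) hn1 (by omega), key n s x hs (hst.trans hn1) (by omega)]
    exact (hf n).const s t x hs hst hn1 ⟨by omega, by omega⟩ hd

theorem IsGoodClocks.isRSOSEvolution_rsosHeight {U : ℤ → Set ℝ} (hU : IsGoodClocks U) :
    IsRSOSEvolution U (fun _ => 0) (rsosHeight U fun _ => 0) :=
  Classical.epsilon_spec hU.exists_isRSOSEvolution

/-- On sufficiently fine time grids, the discrete-time growth agrees with the RSOS surface. -/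
theorem IsGoodClocks.gridHeight_eq_rsosHeight {U : ℤ → Set ℝ} (hU : IsGoodClocks U) (T : ℝ) :
    ∃ η > 0, ∀ s : ℕ → ℝ, Monotone s → s 0 = 0 → ∀ K, s K ≤ T →
      (∀ j < K, s (j + 1) - s j < η) →
        gridHeight (clockCoins U s) (fun _ => 0) K 0 = rsosHeight U (fun _ => 0) (s K) 0 := by
  obtain ⟨l, r, hl, hr, hi⟩ := hU.exists_isIsland ⌈T⌉₊
  obtain ⟨η, hη, h⟩ := hU.exists_mesh hi
  exact ⟨η, hη, fun s hs hs0 K hK hm => h _ (hU.isRSOSEvolution_rsosHeight.isLocalEvolution _ _ _)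
    s hs hs0 K (hK.trans (Nat.le_ceil T)) hm 0 ⟨by omega, by omega⟩⟩

/-! ### Poisson clocks: coins, almost sure properties and passage to fine grids -/

section Clocks

set_option linter.unusedSectionVars false

variable {Ω : Type*} [MeasurableSpace Ω] {μ : Measure Ω} [IsProbabilityMeasure μ]
  {U : Ω → ℤ → Set ℝ}

theorem IsPoissonClocks.iIndepFun_ringCount (hU : IsPoissonClocks U μ) {ι : Type*} {x : ι → ℤ}
    {a b : ι → ℝ} (ha : ∀ i, 0 ≤ a i)
    (hd : Pairwise fun i j => Disjoint ({x i} ×ˢ Ioc (a i) (b i)) ({x j} ×ˢ Ioc (a j) (b j))) :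
    iIndepFun (fun i ω => ringCount (U ω) (x i) (a i) (b i)) μ := by
  rw [iIndepFun_iff_finset]
  intro s
  set e := s.equivFin.symm with he
  rw [← iIndepFun_precomp_of_bijective e.bijective]
  exact hU.indep s.card (fun i => x (e i)) (fun i => a (e i)) (fun i => b (e i)) (fun i => ha _)
    fun i j hij => hd fun h => hij (e.injective (Subtype.ext h))

/-- A cell is free of rings with probability `exp(-length)`, and disjoint cells are independent. The
counts are only almost everywhere measurable, hence the measurable modifications and the almost sure
identification. -/
theorem IsPoissonClocks.exists_coins (hU : IsPoissonClocks U μ) {ι : Type*} [Countable ι]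
    {x : ι → ℤ} {a b : ι → ℝ} (ha : ∀ i, 0 ≤ a i) (hab : ∀ i, a i ≤ b i)
    (hd : Pairwise fun i j => Disjoint ({x i} ×ˢ Ioc (a i) (b i)) ({x j} ×ˢ Ioc (a j) (b j))) :
    ∃ X : ι → Ω → Bool, IsCoins μ X (fun i => 1 - Real.exp (-(b i - a i))) ∧
      ∀ᵐ ω ∂μ, ∀ i, X i ω = true ↔ (U ω (x i) ∩ Ioc (a i) (b i)).Nonempty := by
  set N : ι → Ω → ℕ := fun i ω => ringCount (U ω) (x i) (a i) (b i) with hN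
  have hlaw : ∀ i, HasLaw (N i) (poissonMeasure (b i - a i).toNNReal) μ :=
    fun i => hU.law (x i) (a i) (b i) (ha i) (hab i)
  set N' : ι → Ω → ℕ := fun i => (hlaw i).aemeasurable.mk (N i) with hN'
  have hae : ∀ i, N i =ᵐ[μ] N' i := fun i => (hlaw i).aemeasurable.ae_eq_mk
  have hmeas : ∀ i, Measurable (N' i) := fun i => (hlaw i).aemeasurable.measurable_mk
  refine ⟨fun i ω => decide (N' i ω ≠ 0), ⟨fun i => ?_, ?_, fun i => ?_⟩, ?_⟩
  · exact (measurable_from_top (f := fun n : ℕ => decide (n ≠ 0))).comp (hmeas i)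
  · exact ((hU.iIndepFun_ringCount ha hd).congr hae).comp (fun _ n => decide (n ≠ 0))
      fun _ => measurable_from_top
  · have h0 : μ.real {ω | N' i ω = 0} = Real.exp (-(b i - a i)) := by
      have := ((hlaw i).congr (hae i).symm).measureReal_eq (p := fun n => n = 0)
        (measurableSet_singleton 0)
      rw [this, Set.ofPred_eq_eq_singleton, poissonMeasure_real_singleton,
        Real.coe_toNNReal _ (sub_nonneg.2 (hab i))]
      simp
    have hs : {ω | decide (N' i ω ≠ 0) = true} = {ω | N' i ω = 0}ᶜ := by
      ext ω; simp
    have hm : MeasurableSet {ω | N' i ω = 0} := hmeas i (measurableSet_singleton 0)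
    rw [hs, probReal_compl_eq_one_sub hm, h0]
  · filter_upwards [hU.locallyFinite, ae_all_iff.2 hae] with ω hω h i
    -- Infinite sets have `ncard` zero, so a count of zero means absence of rings only by local
    -- finiteness.
    have hfin : (U ω (x i) ∩ Ioc (a i) (b i)).Finite :=
      ((hω (x i)).2 (b i)).subset (Set.inter_subset_inter_right _ (Ioc_subset_Ioc_left (ha i)))
    rw [decide_eq_true_iff, ← h i, hN, Set.nonempty_iff_ne_empty]
    unfold ringCount
    rw [Ne, Set.ncard_eq_zero hfin]

/-- The first `n` of these clocks all ring with probability `q ^ n`, which tends to zero. -/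
theorem IsPoissonClocks.exists_disjoint (hU : IsPoissonClocks U μ) {x : ℕ → ℤ}
    (hx : x.Injective) (N : ℕ) : ∀ᵐ ω ∂μ, ∃ k, Disjoint (U ω (x k)) (Ioc 0 (N : ℝ)) := by
  obtain ⟨X, hX, h⟩ := hU.exists_coins (x := x) (a := fun _ => 0) (b := fun _ => (N : ℝ))
    (fun _ => le_rfl) (fun _ => Nat.cast_nonneg N) fun i j hij =>
      Set.disjoint_prod.2 (Or.inl (Set.disjoint_singleton.2 fun h => hij (hx h)))
  set q : ℝ := 1 - Real.exp (-(N - 0)) with hq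
  have hq0 : 0 ≤ q := hX.prob 0 ▸ measureReal_nonneg
  have hq1 : q < 1 := by
    have := Real.exp_pos (-(N - 0 : ℝ))
    rw [hq]; linarith
  have hnull : μ {ω | ∀ k, X k ω = true} = 0 := by
    rw [← measureReal_eq_zero_iff]
    refine le_antisymm ?_ measureReal_nonneg
    refine ge_of_tendsto' (tendsto_pow_atTop_nhds_zero_of_lt_one hq0 hq1) fun n => ?_
    have hi := hX.indep.measure_inter_preimage_eq_mul (Finset.range n) (sets := fun _ => {true})
      fun _ _ => measurableSet_singleton _
    have : μ.real (⋂ k ∈ Finset.range n, X k ⁻¹' {true}) = q ^ n := by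
      rw [measureReal_def, hi, ENNReal.toReal_prod]
      calc ∏ k ∈ Finset.range n, (μ (X k ⁻¹' {true})).toReal = ∏ k ∈ Finset.range n, q :=
            Finset.prod_congr rfl fun k _ => hX.prob k
        _ = q ^ n := by simp
    rw [← this]
    refine measureReal_mono fun ω hω => ?_
    simp only [Set.mem_iInter]
    exact fun k _ => hω k
  have hnull' : ∀ᵐ ω ∂μ, ¬ ∀ k, X k ω = true := by
    rw [ae_iff]; simpa using hnull
  filter_upwards [h, hnull'] with ω hω hn
  push Not at hn
  obtain ⟨k, hk⟩ := hn
  refine ⟨k, ?_⟩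
  rw [Set.disjoint_iff_inter_eq_empty, ← Set.not_nonempty_iff_eq_empty, ← hω k]
  exact hk

theorem IsPoissonClocks.ae_isGoodClocks (hU : IsPoissonClocks U μ) :
    ∀ᵐ ω ∂μ, IsGoodClocks (U ω) := by
  have hr : ∀ᵐ ω ∂μ, ∀ N M : ℕ, ∃ k : ℕ, Disjoint (U ω (M + 1 + k)) (Ioc 0 (N : ℝ)) :=
    ae_all_iff.2 fun N => ae_all_iff.2 fun M =>
      hU.exists_disjoint (x := fun k => M + 1 + k) (fun i j h => by simpa using h) N
  have hl : ∀ᵐ ω ∂μ, ∀ N M : ℕ, ∃ k : ℕ, Disjoint (U ω (-(M + 1 + k))) (Ioc 0 (N : ℝ)) :=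
    ae_all_iff.2 fun N => ae_all_iff.2 fun M =>
      hU.exists_disjoint (x := fun k => -(M + 1 + k)) (fun i j h => by simpa using h) N
  filter_upwards [hU.locallyFinite, hr, hl] with ω h h1 h2
  refine ⟨fun x T => (h x).2 T, fun N M => ?_, fun N M => ?_⟩
  · obtain ⟨k, hk⟩ := h1 N M
    exact ⟨_, by omega, hk⟩
  · obtain ⟨k, hk⟩ := h2 N M
    exact ⟨_, by omega, hk⟩

theorem pairwise_disjoint_cells {s : ℕ → ℝ} (hs : Monotone s) {c : ℕ × ℤ → ℝ}
    (hc : ∀ z, c z ≤ s (z.1 + 1)) :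
    Pairwise fun z w : ℕ × ℤ => Disjoint ({z.2} ×ˢ Ioc (s z.1) (c z))
      ({w.2} ×ˢ Ioc (s w.1) (c w)) := by
  intro z w hzw
  rw [Set.disjoint_prod]
  by_cases h : z.2 = w.2
  · right
    have h1 : z.1 ≠ w.1 := fun h1 => hzw (Prod.ext h1 h)
    exact (hs.pairwise_disjoint_on_Ioc_succ h1).mono (Ioc_subset_Ioc_right (hc z))
      (Ioc_subset_Ioc_right (hc w))
  · left
    exact Set.disjoint_singleton.2 h

theorem IsPoissonClocks.exists_clockCoins (hU : IsPoissonClocks U μ) {s : ℕ → ℝ}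
    (hs : Monotone s) (hs0 : s 0 = 0) :
    ∃ X, IsCoins μ X (fun z : ℕ × ℤ => 1 - Real.exp (-(s (z.1 + 1) - s z.1))) ∧
      ∀ᵐ ω ∂μ, (fun z => X z ω) = clockCoins (U ω) s := by
  obtain ⟨X, hX, h⟩ := hU.exists_coins (x := fun z : ℕ × ℤ => z.2) (a := fun z => s z.1)
    (b := fun z => s (z.1 + 1)) (fun z => hs0 ▸ hs (Nat.zero_le _)) (fun z => hs (Nat.le_succ _))
    (pairwise_disjoint_cells hs fun z => le_rfl)
  refine ⟨X, hX, ?_⟩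
  filter_upwards [h] with ω hω
  funext z
  rw [Bool.eq_iff_iff, hω z, clockCoins_eq_true]

/-- Each raise uses up a cell with a ring. This gives one square integrable majorant for all grids,
as dominated convergence requires. -/
theorem IsGoodClocks.gridHeight_le_ringCount {V : ℤ → Set ℝ} (hV : IsGoodClocks V) {s : ℕ → ℝ}
    (hs : Monotone s) (hs0 : s 0 = 0) (j : ℕ) (x : ℤ) :
    gridHeight (clockCoins V s) (fun _ => 0) j x ≤ ringCount V x 0 (s j) := by
  induction j with
  | zero => simp [gridHeight]
  | succ j ih =>
    refine (gridHeight_le_succ isGentle_zero _ j x).2.trans ?_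
    have hfin := hV.finite x (s (j + 1))
    have hle : s j ≤ s (j + 1) := hs (Nat.le_succ j)
    have hsj : 0 ≤ s j := hs0 ▸ hs (Nat.zero_le j)
    have hsub : V x ∩ Ioc 0 (s j) ⊆ V x ∩ Ioc 0 (s (j + 1)) :=
      Set.inter_subset_inter_right _ (Ioc_subset_Ioc_right hle)
    have hc : (ringCount V x 0 (s j) : ℤ) + (if clockCoins V s (j, x) then 1 else 0) ≤
        ringCount V x 0 (s (j + 1)) := by
      unfold ringCount
      split_ifs with h
      · obtain ⟨τ, hτ, hτI⟩ := clockCoins_eq_true.1 h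
        have : (V x ∩ Ioc 0 (s j)).ncard < (V x ∩ Ioc 0 (s (j + 1))).ncard := by
          refine Set.ncard_lt_ncard (Set.ssubset_iff_exists.2 ⟨hsub, τ, ?_, ?_⟩) hfin
          · exact ⟨hτ, hsj.trans_lt hτI.1, hτI.2⟩
          · exact fun h => absurd h.2.2 (not_le.2 hτI.1)
        omega
      · have := Set.ncard_le_ncard hsub hfin
        omega
    omega

theorem integrable_sq_poissonMeasure (r : NNReal) :
    Integrable (fun n : ℕ => (n : ℝ) ^ 2) (poissonMeasure r) := by
  rw [integrable_poissonMeasure_iff]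
  refine Summable.of_nonneg_of_le (fun n => by positivity) (fun n => ?_)
    ((Real.summable_pow_div_factorial (4 * r)).mul_left (Real.exp (-r)))
  have h : (n : ℝ) ^ 2 ≤ 4 ^ n := by
    have h1 : (n : ℝ) ≤ 2 ^ n := by exact_mod_cast Nat.lt_two_pow_self.le
    calc (n : ℝ) ^ 2 ≤ (2 ^ n) ^ 2 := pow_le_pow_left₀ (by positivity) h1 2
      _ = 4 ^ n := by rw [← pow_mul, mul_comm, pow_mul]; norm_num
  rw [Real.norm_of_nonneg (by positivity), mul_pow, mul_div_assoc, mul_assoc]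
  refine mul_le_mul_of_nonneg_left ?_ (Real.exp_pos _).le
  rw [mul_div_assoc, mul_comm]
  exact mul_le_mul_of_nonneg_right h (by positivity)

theorem IsPoissonClocks.memLp_ringCount (hU : IsPoissonClocks U μ) (x : ℤ) {T : ℝ} (hT : 0 ≤ T) :
    MemLp (fun ω => (ringCount (U ω) x 0 T : ℝ)) 2 μ := by
  have h := hU.law x 0 T le_rfl hT
  have hm : MemLp (fun n : ℕ => (n : ℝ)) 2 (poissonMeasure (T - 0).toNNReal) :=
    (memLp_two_iff_integrable_sq measurable_from_top.aestronglyMeasurable).2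
      (integrable_sq_poissonMeasure _)
  rw [← h.map_eq] at hm
  exact (memLp_map_measure_iff measurable_from_top.aestronglyMeasurable h.aemeasurable).1 hm

theorem IsPoissonClocks.aemeasurable_gridHeight (hU : IsPoissonClocks U μ) {s : ℕ → ℝ}
    (hs : Monotone s) (hs0 : s 0 = 0) (j : ℕ) (x : ℤ) :
    AEMeasurable (fun ω => (gridHeight (clockCoins (U ω) s) (fun _ => 0) j x : ℝ)) μ := by
  obtain ⟨X, hX, h⟩ := hU.exists_clockCoins hs hs0
  refine (hX.measurable_comp (dependsOn_gridHeight_cast (fun _ => 0) j x)).aemeasurable.congr ?_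
  filter_upwards [h] with ω hω
  simp only [hω]

theorem IsPoissonClocks.memLp_gridHeight (hU : IsPoissonClocks U μ) {s : ℕ → ℝ}
    (hs : Monotone s) (hs0 : s 0 = 0) (j : ℕ) (x : ℤ) :
    MemLp (fun ω => (gridHeight (clockCoins (U ω) s) (fun _ => 0) j x : ℝ)) 2 μ := by
  refine (hU.memLp_ringCount x (hs0 ▸ hs (Nat.zero_le j) : 0 ≤ s j)).of_le
    (hU.aemeasurable_gridHeight hs hs0 j x).aestronglyMeasurable ?_
  filter_upwards [hU.ae_isGoodClocks] with ω hω
  have h0 := gridHeight_zero_nonneg (clockCoins (U ω) s) j x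
  have h1 := hω.gridHeight_le_ringCount hs hs0 j x
  rw [Real.norm_of_nonneg (by exact_mod_cast h0), Real.norm_of_nonneg (by positivity)]
  exact_mod_cast h1

/-- A sequence of time grids of `[0, T]`, the `n`-th one with `K n` cells, with mesh size tending
to zero. -/
structure IsGridSequence (s : ℕ → ℕ → ℝ) (K : ℕ → ℕ) (T : ℝ) : Prop where
  mono : ∀ n, Monotone (s n)
  zero : ∀ n, s n 0 = 0
  last : ∀ n, s n (K n) = T
  mesh : ∀ η > 0, ∀ᶠ n in atTop, ∀ j < K n, s n (j + 1) - s n j < η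

theorem IsGridSequence.nonneg {s : ℕ → ℕ → ℝ} {K : ℕ → ℕ} {T : ℝ} (h : IsGridSequence s K T) :
    0 ≤ T := by
  rw [← h.last 0, ← h.zero 0]
  exact h.mono 0 (Nat.zero_le _)

variable {s : ℕ → ℕ → ℝ} {K : ℕ → ℕ} {T : ℝ}

theorem IsPoissonClocks.ae_tendsto_gridHeight (hU : IsPoissonClocks U μ)
    (hs : IsGridSequence s K T) : ∀ᵐ ω ∂μ, Tendsto
      (fun n => (gridHeight (clockCoins (U ω) (s n)) (fun _ => 0) (K n) 0 : ℝ)) atTop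
      (𝓝 (rsosHeight (U ω) (fun _ => 0) T 0 : ℝ)) := by
  filter_upwards [hU.ae_isGoodClocks] with ω hω
  obtain ⟨η, hη, h⟩ := hω.gridHeight_eq_rsosHeight T
  refine tendsto_const_nhds.congr' ?_
  filter_upwards [hs.mesh η hη] with n hn
  rw [h (s n) (hs.mono n) (hs.zero n) (K n) (hs.last n).le hn, hs.last n]

theorem IsPoissonClocks.ae_gridHeight_bound (hU : IsPoissonClocks U μ)
    (hs : IsGridSequence s K T) : ∀ᵐ ω ∂μ, ∀ n,
      |(gridHeight (clockCoins (U ω) (s n)) (fun _ => 0) (K n) 0 : ℝ)| ≤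
        ringCount (U ω) 0 0 T := by
  filter_upwards [hU.ae_isGoodClocks] with ω hω n
  have h0 := gridHeight_zero_nonneg (clockCoins (U ω) (s n)) (K n) 0
  have h1 := hω.gridHeight_le_ringCount (hs.mono n) (hs.zero n) (K n) 0
  rw [hs.last n] at h1
  rw [abs_of_nonneg (by exact_mod_cast h0)]
  exact_mod_cast h1

theorem IsPoissonClocks.memLp_rsosHeight (hU : IsPoissonClocks U μ) (hs : IsGridSequence s K T) :
    MemLp (fun ω => (rsosHeight (U ω) (fun _ => 0) T 0 : ℝ)) 2 μ := by
  refine (hU.memLp_ringCount 0 hs.nonneg).of_le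
    (aemeasurable_of_tendsto_metrizable_ae atTop (fun n => hU.aemeasurable_gridHeight
      (hs.mono n) (hs.zero n) (K n) 0) (hU.ae_tendsto_gridHeight hs)).aestronglyMeasurable ?_
  filter_upwards [hU.ae_tendsto_gridHeight hs, hU.ae_gridHeight_bound hs] with ω h1 h2
  rw [Real.norm_of_nonneg (Nat.cast_nonneg _), Real.norm_eq_abs]
  exact le_of_tendsto' h1.abs h2

theorem IsPoissonClocks.tendsto_integral_gridHeight (hU : IsPoissonClocks U μ)
    (hs : IsGridSequence s K T) : Tendsto
      (fun n => ∫ ω, (gridHeight (clockCoins (U ω) (s n)) (fun _ => 0) (K n) 0 : ℝ) ∂μ) atTop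
      (𝓝 (∫ ω, (rsosHeight (U ω) (fun _ => 0) T 0 : ℝ) ∂μ)) :=
  tendsto_integral_of_dominated_convergence (fun ω => (ringCount (U ω) 0 0 T : ℝ))
    (fun n => (hU.aemeasurable_gridHeight (hs.mono n) (hs.zero n) (K n) 0).aestronglyMeasurable)
    ((hU.memLp_ringCount 0 hs.nonneg).integrable one_le_two)
    (fun n => (hU.ae_gridHeight_bound hs).mono fun _ h => h n) (hU.ae_tendsto_gridHeight hs)

theorem IsPoissonClocks.tendsto_variance_gridHeight (hU : IsPoissonClocks U μ)
    (hs : IsGridSequence s K T) : Tendsto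
      (fun n => Var[fun ω => (gridHeight (clockCoins (U ω) (s n)) (fun _ => 0) (K n) 0 : ℝ); μ])
      atTop (𝓝 Var[fun ω => (rsosHeight (U ω) (fun _ => 0) T 0 : ℝ); μ]) := by
  rw [variance_eq_sub (hU.memLp_rsosHeight hs)]
  simp_rw [fun n => variance_eq_sub (hU.memLp_gridHeight (hs.mono n) (hs.zero n) (K n) 0)]
  refine Tendsto.sub ?_ ((hU.tendsto_integral_gridHeight hs).pow 2)
  refine tendsto_integral_of_dominated_convergence (fun ω => (ringCount (U ω) 0 0 T : ℝ) ^ 2)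
    (fun n => ((hU.aemeasurable_gridHeight (hs.mono n) (hs.zero n) (K n)
      0).pow_const 2).aestronglyMeasurable)
    (hU.memLp_ringCount 0 hs.nonneg).integrable_sq
    (fun n => (hU.ae_gridHeight_bound hs).mono fun _ h => ?_)
    ((hU.ae_tendsto_gridHeight hs).mono fun ω h => h.pow 2)
  rw [Pi.pow_apply, norm_pow, Real.norm_eq_abs]
  exact pow_le_pow_left₀ (abs_nonneg _) (h n) 2

end Clocks

/-! ### Grids resolving two times -/

section Grids

/-- The grid with step `c` for the first `N` steps and step `d` afterwards. -/
def twoStepGrid (c d : ℝ) (N j : ℕ) : ℝ := min j N * c + (j - N : ℕ) * d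

theorem twoStepGrid_of_le {c d : ℝ} {N j : ℕ} (h : j ≤ N) : twoStepGrid c d N j = j * c := by
  simp [twoStepGrid, h, Nat.sub_eq_zero_of_le h]

theorem twoStepGrid_add (c d : ℝ) (N j : ℕ) : twoStepGrid c d N (N + j) = N * c + j * d := by
  simp [twoStepGrid]

theorem twoStepGrid_succ_sub (c d : ℝ) (N j : ℕ) :
    twoStepGrid c d N (j + 1) - twoStepGrid c d N j = if j < N then c else d := by
  split_ifs with h
  · rw [twoStepGrid_of_le h, twoStepGrid_of_le h.le]
    push_cast
    ring
  · obtain ⟨k, rfl⟩ := Nat.exists_eq_add_of_le (not_lt.1 h)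
    rw [add_assoc, twoStepGrid_add, twoStepGrid_add]
    push_cast
    ring

theorem monotone_twoStepGrid {c d : ℝ} (hc : 0 ≤ c) (hd : 0 ≤ d) (N : ℕ) :
    Monotone (twoStepGrid c d N) :=
  monotone_nat_of_le_succ fun j => by
    have := twoStepGrid_succ_sub c d N j
    split_ifs at this <;> linarith

theorem eventually_div_lt (T : ℝ) {η : ℝ} (hη : 0 < η) :
    ∀ᶠ n : ℕ in atTop, T / ((n + 1 : ℕ) : ℝ) < η :=
  (((tendsto_const_nhds (x := T)).div_atTop tendsto_natCast_atTop_atTop).comp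
    (tendsto_add_atTop_nat 1)).eventually_lt_const hη

theorem isGridSequence_first {t T : ℝ} (ht : 0 ≤ t) (hT : 0 ≤ T) :
    IsGridSequence (fun n => twoStepGrid (t / (n + 1 : ℕ)) (T / (n + 1 : ℕ)) (n + 1))
      (fun n => n + 1) t where
  mono n := monotone_twoStepGrid (by positivity) (by positivity) _
  zero n := by simp [twoStepGrid]
  last n := by
    rw [twoStepGrid_of_le le_rfl]
    field_simp
  mesh η hη := by
    filter_upwards [eventually_div_lt t hη] with n hn j hj
    rwa [twoStepGrid_succ_sub, if_pos hj]

/-- The grids are those of `isGridSequence_first` with more steps, so the same coins drive the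
surfaces at both times. -/
theorem isGridSequence_both {t T : ℝ} (ht : 0 ≤ t) (hT : 0 ≤ T) :
    IsGridSequence (fun n => twoStepGrid (t / (n + 1 : ℕ)) (T / (n + 1 : ℕ)) (n + 1))
      (fun n => n + 1 + (n + 1)) (t + T) where
  mono n := monotone_twoStepGrid (by positivity) (by positivity) _
  zero n := by simp [twoStepGrid]
  last n := by
    rw [twoStepGrid_add]
    field_simp
  mesh η hη := by
    filter_upwards [eventually_div_lt t hη, eventually_div_lt T hη] with n hn hn' j _
    rw [twoStepGrid_succ_sub]
    split_ifs
    · exact hn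
    · exact hn'

end Grids

/-! ### Growth of a flat surface in continuous time -/

section Growth

variable {Ω : Type*} [MeasurableSpace Ω] {μ : Measure Ω} [IsProbabilityMeasure μ]
  {U : Ω → ℤ → Set ℝ}

theorem one_sub_exp_neg_le (x : ℝ) : 1 - Real.exp (-x) ≤ x := by
  linarith [Real.add_one_le_exp (-x)]

theorem half_le_one_sub_exp_neg {x : ℝ} (h0 : 0 ≤ x) (h1 : x ≤ 1) : x / 2 ≤ 1 - Real.exp (-x) := by
  have h := Real.add_one_le_exp x
  rw [Real.exp_neg, le_sub_comm, inv_le_comm₀ (Real.exp_pos x) (by linarith)]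
  refine le_trans ?_ h
  rw [inv_le_iff_one_le_mul₀ (by linarith)]
  nlinarith

/-- Limit of the discrete bound. For small steps `x / 2 ≤ 1 - exp(-x) ≤ x`, so the success
probabilities after time `t` sum to between `30 l` and `60 l`. The strict variance bound is
inherited by fine grids. -/
theorem IsPoissonClocks.le_integral_rsosHeight_sub (hU : IsPoissonClocks U μ) {t : ℝ} (ht : 0 ≤ t)
    {l : ℕ} (hl : 1 ≤ l)
    (hvar : Var[fun ω => (rsosHeight (U ω) (fun _ => 0) t 0 : ℝ); μ] < (l : ℝ) ^ 2 / 1000) :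
    (l : ℝ) ≤ ∫ ω, (rsosHeight (U ω) (fun _ => 0) (t + 60 * l) 0 : ℝ) ∂μ -
      ∫ ω, (rsosHeight (U ω) (fun _ => 0) t 0 : ℝ) ∂μ := by
  have hT : (0 : ℝ) ≤ 60 * l := by positivity
  have h1 := isGridSequence_first ht hT
  have h2 := isGridSequence_both ht hT
  refine ge_of_tendsto
    ((hU.tendsto_integral_gridHeight h2).sub (hU.tendsto_integral_gridHeight h1)) ?_
  filter_upwards [(hU.tendsto_variance_gridHeight h1).eventually_lt_const hvar,
    eventually_div_lt (60 * l : ℝ) one_pos] with n hn hn1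
  obtain ⟨X, hX, hXU⟩ := hU.exists_clockCoins (h1.mono n) (h1.zero n)
  set s := twoStepGrid (t / (n + 1 : ℕ)) (60 * l / (n + 1 : ℕ)) (n + 1) with hs
  have hE : ∀ k, ∫ ω, (gridHeight (clockCoins (U ω) s) (fun _ => 0) k 0 : ℝ) ∂μ =
      ∫ ω, (gridHeight (fun z => X z ω) (fun _ => 0) k 0 : ℝ) ∂μ := fun k =>
    integral_congr_ae (hXU.mono fun ω h => by simp only [h])
  have hV : Var[fun ω => (gridHeight (clockCoins (U ω) s) (fun _ => 0) (n + 1) 0 : ℝ); μ] =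
      Var[fun ω => (gridHeight (fun z => X z ω) (fun _ => 0) (n + 1) 0 : ℝ); μ] :=
    variance_congr (hXU.mono fun ω h => by simp only [h])
  rw [hV] at hn
  rw [hE, hE]
  have hr0 : ∀ j, 0 ≤ s (j + 1) - s j := fun j => sub_nonneg.2 (h1.mono n (Nat.le_succ j))
  have hsum : ∑ j ∈ Finset.range (n + 1), (1 - Real.exp (-(s (n + 1 + j + 1) - s (n + 1 + j)))) =
      (n + 1 : ℕ) * (1 - Real.exp (-(60 * l / (n + 1 : ℕ)))) := by
    rw [Finset.sum_congr rfl fun j _ => by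
      rw [hs, twoStepGrid_succ_sub, if_neg (by omega)]]
    rw [Finset.sum_const, Finset.card_range, nsmul_eq_mul]
  have hpos : (0 : ℝ) < ((n + 1 : ℕ) : ℝ) := by positivity
  have hmul : ((n + 1 : ℕ) : ℝ) * (60 * l / (n + 1 : ℕ)) = 60 * l := by field_simp
  refine le_integral_gridHeight_sub (r := fun j => 1 - Real.exp (-(s (j + 1) - s j))) hX
    (fun z => rfl) (fun j => ⟨?_, ?_⟩) hl ?_ ?_ hn.le
  · rw [sub_nonneg, Real.exp_le_one_iff]
    linarith [hr0 j]
  · linarith [Real.exp_pos (-(s (j + 1) - s j))]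
  · rw [hsum]
    have := mul_le_mul_of_nonneg_left (half_le_one_sub_exp_neg (by positivity) hn1.le) hpos.le
    linarith
  · rw [hsum]
    have := mul_le_mul_of_nonneg_left (one_sub_exp_neg_le (60 * l / (n + 1 : ℕ))) hpos.le
    linarith

end Growth

/-! ### The dilated time grid and the chi-square cost of the cone -/

section DilatedGrid

/-- The remaining time after `j` steps of length `δ`, cut off at `√t`. -/
noncomputable def cutoffTime (t δ : ℝ) (j : ℕ) : ℝ := max (t - j * δ) (Real.sqrt t)

/-- The time grid whose `j`-th step is longer than `δ` by about `a δ / (t - j δ)`, as long as the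
remaining time is at least `√t`. -/
noncomputable def dilatedGrid (t a δ : ℝ) (j : ℕ) : ℝ :=
  j * δ + a * Real.log (t / cutoffTime t δ j)

/-- The excess of the `j`-th step of the dilated grid over `δ`. -/
noncomputable def dilation (t a δ : ℝ) (j : ℕ) : ℝ :=
  a * Real.log (cutoffTime t δ j / cutoffTime t δ (j + 1))

variable {t a δ : ℝ}

theorem sqrt_le_cutoffTime (t δ : ℝ) (j : ℕ) : Real.sqrt t ≤ cutoffTime t δ j := le_max_right _ _

theorem cutoffTime_pos (ht : 1 ≤ t) (j : ℕ) : 0 < cutoffTime t δ j :=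
  (Real.sqrt_pos.2 (by linarith)).trans_le (sqrt_le_cutoffTime t δ j)

theorem one_le_cutoffTime (ht : 1 ≤ t) (j : ℕ) : 1 ≤ cutoffTime t δ j :=
  (Real.one_le_sqrt.2 ht).trans (sqrt_le_cutoffTime t δ j)

theorem cutoffTime_succ_le (hδ : 0 ≤ δ) (j : ℕ) : cutoffTime t δ (j + 1) ≤ cutoffTime t δ j := by
  unfold cutoffTime
  push_cast
  exact max_le_max (by linarith) le_rfl

theorem cutoffTime_le_succ_add (hδ : 0 ≤ δ) (j : ℕ) :
    cutoffTime t δ j ≤ cutoffTime t δ (j + 1) + δ := by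
  unfold cutoffTime
  push_cast
  rw [← max_add_add_right]
  exact max_le_max (by linarith) (by linarith)

theorem cutoffTime_zero (ht : 1 ≤ t) : cutoffTime t δ 0 = t := by
  unfold cutoffTime
  rw [Nat.cast_zero, zero_mul, sub_zero, max_eq_left (Real.sqrt_le_iff.2 ⟨by linarith, by nlinarith⟩)]

theorem dilation_nonneg (ht : 1 ≤ t) (ha : 0 ≤ a) (hδ : 0 ≤ δ) (j : ℕ) : 0 ≤ dilation t a δ j :=
  mul_nonneg ha (Real.log_nonneg ((one_le_div (cutoffTime_pos ht _)).2 (cutoffTime_succ_le hδ j)))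

theorem dilation_le (ht : 1 ≤ t) (ha : 0 ≤ a) (hδ : 0 ≤ δ) (j : ℕ) :
    dilation t a δ j ≤ a * δ / cutoffTime t δ (j + 1) := by
  have hV := cutoffTime_pos (δ := δ) ht (j + 1)
  rw [mul_div_assoc]
  refine mul_le_mul_of_nonneg_left ?_ ha
  refine (Real.log_le_sub_one_of_pos (div_pos (cutoffTime_pos ht j) hV)).trans ?_
  rw [div_sub_one hV.ne']
  exact div_le_div_of_nonneg_right (by linarith [cutoffTime_le_succ_add (t := t) hδ j]) hV.le

theorem dilatedGrid_succ_sub (ht : 1 ≤ t) (j : ℕ) :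
    dilatedGrid t a δ (j + 1) - dilatedGrid t a δ j = δ + dilation t a δ j := by
  have h0 : t ≠ 0 := by linarith
  have h1 := (cutoffTime_pos (δ := δ) ht j).ne'
  have h2 := (cutoffTime_pos (δ := δ) ht (j + 1)).ne'
  unfold dilatedGrid dilation
  rw [Real.log_div h0 h1, Real.log_div h0 h2, Real.log_div h1 h2]
  push_cast
  ring

theorem monotone_dilatedGrid (ht : 1 ≤ t) (ha : 0 ≤ a) (hδ : 0 ≤ δ) :
    Monotone (dilatedGrid t a δ) :=
  monotone_nat_of_le_succ fun j => by
    have := dilatedGrid_succ_sub (a := a) (δ := δ) ht j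
    linarith [dilation_nonneg ht ha hδ j]

theorem dilatedGrid_zero (ht : 1 ≤ t) : dilatedGrid t a δ 0 = 0 := by
  unfold dilatedGrid
  rw [cutoffTime_zero ht, div_self (by linarith)]
  simp

theorem dilatedGrid_last (ht : 1 ≤ t) {N : ℕ} (hN : N * δ = t) :
    dilatedGrid t a δ N = t + a * (Real.log t / 2) := by
  unfold dilatedGrid cutoffTime
  rw [hN, sub_self, max_eq_right (Real.sqrt_nonneg t), Real.div_sqrt, Real.log_sqrt (by linarith)]

/-- With `V` the cut-off remaining time, the undilated part is at most `V`, and the rest is `a log(V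
/ √t) ≤ a V / √t ≤ V`. -/
theorem dilatedGrid_last_sub_le (ht : 1 ≤ t) (ha : 0 ≤ a) (hat : a ≤ Real.sqrt t) {N : ℕ}
    (hN : N * δ = t) (j : ℕ) :
    dilatedGrid t a δ N - dilatedGrid t a δ j ≤ 2 * cutoffTime t δ j := by
  have hs : 0 < Real.sqrt t := Real.sqrt_pos.2 (by linarith)
  have hV := cutoffTime_pos (δ := δ) ht j
  have e : dilatedGrid t a δ N - dilatedGrid t a δ j =
      (t - j * δ) + a * Real.log (cutoffTime t δ j / Real.sqrt t) := by
    rw [dilatedGrid_last ht hN]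
    unfold dilatedGrid
    rw [Real.log_div (by linarith : t ≠ 0) hV.ne', Real.log_div hV.ne' hs.ne',
      Real.log_sqrt (by linarith)]
    ring
  have h1 : t - j * δ ≤ cutoffTime t δ j := le_max_left _ _
  have h2 : a * Real.log (cutoffTime t δ j / Real.sqrt t) ≤ cutoffTime t δ j := by
    calc a * Real.log (cutoffTime t δ j / Real.sqrt t) ≤ a * (cutoffTime t δ j / Real.sqrt t) :=
          mul_le_mul_of_nonneg_left (Real.log_le_self (by positivity)) ha
      _ ≤ Real.sqrt t * (cutoffTime t δ j / Real.sqrt t) :=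
          mul_le_mul_of_nonneg_right hat (by positivity)
      _ = cutoffTime t δ j := by field_simp
  linarith

theorem isGridSequence_dilated (ht : 1 ≤ t) (ha : 0 ≤ a) :
    IsGridSequence (fun n => dilatedGrid t a (t / (n + 1 : ℕ))) (fun n => n + 1)
      (t + a * (Real.log t / 2)) where
  mono n := monotone_dilatedGrid ht ha (by positivity)
  zero n := dilatedGrid_zero ht
  last n := dilatedGrid_last ht (by field_simp)
  mesh η hη := by
    filter_upwards [eventually_div_lt ((1 + a) * t) hη] with n hn j _
    have hδ : 0 ≤ t / (n + 1 : ℕ) := by positivity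
    rw [dilatedGrid_succ_sub ht]
    have h1 := dilation_le ht ha hδ j
    have h2 : a * (t / (n + 1 : ℕ)) / cutoffTime t (t / (n + 1 : ℕ)) (j + 1) ≤
        a * (t / (n + 1 : ℕ)) := div_le_self (by positivity) (one_le_cutoffTime ht _)
    rw [mul_div_assoc, add_mul, one_mul] at hn
    linarith

/-- The cells within distance `10 V` of the origin, where `V` is the remaining time. -/
noncomputable def coneMask (t δ : ℝ) (z : ℕ × ℤ) : Bool :=
  decide (|(z.2 : ℝ)| ≤ 10 * cutoffTime t δ z.1)

/-- Supplies the barrier hypothesis of `integral_maskDiff_le`. Outside the cone `cosh x ≥ exp(10 V)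
/ 2`, while the factors of the remaining steps multiply to at most `exp(8 V)`. The surplus `exp(2 V)
/ 2` beats `exp(√t)`, since `√t ≤ V` and `exp V ≥ 2`. -/
theorem one_le_of_coneMask_eq_false (ht : 1 ≤ t) (ha : 0 ≤ a) (hat : a ≤ Real.sqrt t)
    (hδ : 0 ≤ δ) {N : ℕ} (hN : N * δ = t) {j : ℕ} {x : ℤ} (hj : j < N)
    (h : coneMask t δ (j, x) = false) :
    1 ≤ Real.exp (-Real.sqrt t) / (∏ i ∈ Finset.range N, (1 + 4 * (δ + dilation t a δ i))) *
      (∏ i ∈ Finset.range (j + 1), (1 + 4 * (δ + dilation t a δ i))) * Real.cosh x := by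
  have hd := dilation_nonneg ht ha hδ
  set V := cutoffTime t δ j with hV
  have hx : 10 * V < |(x : ℝ)| := by simpa [coneMask] using h
  have hsV : Real.sqrt t ≤ V := sqrt_le_cutoffTime t δ j
  have hs1 : 1 ≤ Real.sqrt t := Real.one_le_sqrt.2 ht
  have hsplit : ∏ i ∈ Finset.range N, (1 + 4 * (δ + dilation t a δ i)) =
      (∏ i ∈ Finset.range (j + 1), (1 + 4 * (δ + dilation t a δ i))) *
        ∏ i ∈ Finset.Ico (j + 1) N, (1 + 4 * (δ + dilation t a δ i)) :=
    (Finset.prod_range_mul_prod_Ico _ hj).symm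
  set P := ∏ i ∈ Finset.range (j + 1), (1 + 4 * (δ + dilation t a δ i))
  set Q := ∏ i ∈ Finset.Ico (j + 1) N, (1 + 4 * (δ + dilation t a δ i)) with hQ
  have hP0 : 0 < P := Finset.prod_pos fun i _ => by linarith [hd i]
  have hQ0 : 0 < Q := Finset.prod_pos fun i _ => by linarith [hd i]
  have hQle : Q ≤ Real.exp (8 * V) := by
    calc Q ≤ ∏ i ∈ Finset.Ico (j + 1) N, Real.exp (4 * (δ + dilation t a δ i)) :=
          Finset.prod_le_prod (fun i _ => by linarith [hd i]) fun i _ => by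
            linarith [Real.add_one_le_exp (4 * (δ + dilation t a δ i))]
      _ = Real.exp (4 * (dilatedGrid t a δ N - dilatedGrid t a δ (j + 1))) := by
          rw [← Real.exp_sum, ← Finset.mul_sum, ← Finset.sum_Ico_sub _ (by omega : j + 1 ≤ N)]
          simp_rw [dilatedGrid_succ_sub ht]
      _ ≤ Real.exp (8 * V) := by
          rw [Real.exp_le_exp]
          have h1 := dilatedGrid_last_sub_le ht ha hat hN j
          have h2 := monotone_dilatedGrid ht ha hδ (Nat.le_succ j)
          linarith
  have hcosh : Real.exp (10 * V) / 2 ≤ Real.cosh x := by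
    rw [← Real.cosh_abs, Real.cosh_eq]
    have := Real.exp_le_exp.2 hx.le
    linarith [Real.exp_pos (-|(x : ℝ)|)]
  have h2 : (2 : ℝ) ≤ Real.exp V := by
    have := Real.add_one_le_exp V
    linarith
  have e : Real.exp (-Real.sqrt t) / (P * Q) * P * Real.cosh x =
      Real.exp (-Real.sqrt t) * Real.cosh x / Q := by field_simp
  rw [hsplit, e, one_le_div hQ0]
  refine hQle.trans ?_
  calc Real.exp (8 * V) ≤ Real.exp (8 * V) * (Real.exp V / 2) :=
        le_mul_of_one_le_right (Real.exp_pos _).le (by linarith)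
    _ = Real.exp (-V) * (Real.exp (10 * V) / 2) := by
        rw [← mul_div_assoc, ← mul_div_assoc, ← Real.exp_add, ← Real.exp_add]
        ring_nf
    _ ≤ Real.exp (-Real.sqrt t) * Real.cosh x :=
        mul_le_mul (Real.exp_le_exp.2 (by linarith)) hcosh (by positivity) (Real.exp_pos _).le

/-- The chi-square distance of two coins that record the rings during times `δ` and `δ + c`. -/
theorem chiSquare_coin_le {c : ℝ} (hδ : 0 < δ) (hc : 0 ≤ c) :
    ((1 - Real.exp (-(δ + c))) - (1 - Real.exp (-δ))) ^ 2 /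
      ((1 - Real.exp (-δ)) * (1 - (1 - Real.exp (-δ)))) ≤ c ^ 2 / δ := by
  set e := Real.exp (-δ) with he
  have he0 : 0 < e := Real.exp_pos _
  have he1 : e < 1 := Real.exp_zero ▸ Real.exp_lt_exp.2 (by linarith : -δ < 0)
  have h1 : Real.exp (-(δ + c)) = e * Real.exp (-c) := by rw [neg_add, Real.exp_add]
  have h2 : 0 ≤ 1 - Real.exp (-c) := sub_nonneg.2 (Real.exp_le_one_iff.2 (by linarith))
  have h3 := one_sub_exp_neg_le c
  have h4 : δ * e ≤ 1 - e := by
    have : 1 / e = Real.exp δ := by rw [he, Real.exp_neg, one_div, inv_inv]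
    have h5 := Real.add_one_le_exp δ
    rw [← this, le_div_iff₀ he0] at h5
    linarith
  have h5 : (1 - Real.exp (-c)) ^ 2 ≤ c ^ 2 := pow_le_pow_left₀ h2 h3 2
  rw [h1, div_le_div_iff₀ (mul_pos (by linarith) (by linarith)) hδ]
  calc (1 - e * Real.exp (-c) - (1 - e)) ^ 2 * δ
      = (1 - Real.exp (-c)) ^ 2 * (e * (δ * e)) := by ring
    _ ≤ c ^ 2 * (e * (1 - e)) :=
        mul_le_mul h5 (mul_le_mul_of_nonneg_left h4 he0.le) (by positivity) (by positivity)
    _ = c ^ 2 * ((1 - e) * (1 - (1 - e))) := by ring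

theorem sum_coneMask_le (ht : 1 ≤ t) (j : ℕ) {w : ℝ} (hw : 0 ≤ w) (s : Finset ℤ) :
    ∑ x ∈ s, (if coneMask t δ (j, x) then w else 0) ≤ 21 * cutoffTime t δ j * w := by
  have hV := one_le_cutoffTime (δ := δ) ht j
  set V := cutoffTime t δ j with hVdef
  rw [← Finset.sum_filter, Finset.sum_const, nsmul_eq_mul]
  refine mul_le_mul_of_nonneg_right ?_ hw
  have hsub : s.filter (fun x => coneMask t δ (j, x) = true) ⊆ Finset.Icc (-⌊10 * V⌋) ⌊10 * V⌋ := by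
    intro x hx
    have hx' : |(x : ℝ)| ≤ 10 * V := by
      simpa [coneMask] using (Finset.mem_filter.1 hx).2
    rw [abs_le] at hx'
    rw [Finset.mem_Icc, neg_le, Int.le_floor, Int.le_floor]
    push_cast
    constructor <;> linarith
  have hcard := Finset.card_le_card hsub
  rw [Int.card_Icc] at hcard
  have hfl : (0 : ℤ) ≤ ⌊10 * V⌋ := Int.floor_nonneg.2 (by linarith)
  have h1 : ((s.filter fun x => coneMask t δ (j, x) = true).card : ℤ) ≤ 2 * ⌊10 * V⌋ + 1 := by
    omega
  have h2 : (((s.filter fun x => coneMask t δ (j, x) = true).card : ℤ) : ℝ) ≤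
      ((2 * ⌊10 * V⌋ + 1 : ℤ) : ℝ) := Int.cast_le.2 h1
  push_cast at h2
  have h3 := Int.floor_le (10 * V)
  linarith

/-- A layer has at most `21 V` cone sites, each costing `c² / δ` with `c ≤ a δ / V'`, where `V'` is
the next cutoff time. As `V ≤ 2 V'`, the layer costs at most `42 a c`, and the dilations `c` sum to
`a log t / 2`. -/
theorem sum_chiSquare_le (ht : 1 ≤ t) (ha : 0 ≤ a) (hδ : 0 < δ) (hδt : δ ≤ Real.sqrt t) {N : ℕ}
    (hN : N * δ = t) (s : Finset ℤ) :
    ∑ z ∈ Finset.range N ×ˢ s,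
      (if coneMask t δ z then dilation t a δ z.1 ^ 2 / δ else 0) ≤ 21 * a ^ 2 * Real.log t := by
  have hd := dilation_nonneg ht ha hδ.le
  rw [Finset.sum_product]
  calc ∑ j ∈ Finset.range N, ∑ x ∈ s,
        (if coneMask t δ (j, x) then dilation t a δ j ^ 2 / δ else 0)
      ≤ ∑ j ∈ Finset.range N, 42 * a * dilation t a δ j := by
        refine Finset.sum_le_sum fun j _ => ?_
        refine (sum_coneMask_le ht j (by positivity) s).trans ?_
        have hV := cutoffTime_pos (δ := δ) ht (j + 1)
        have h1 := dilation_le ht ha hδ.le j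
        have h2 := cutoffTime_le_succ_add (t := t) hδ.le j
        have h3 := sqrt_le_cutoffTime t δ (j + 1)
        have h4 : cutoffTime t δ j ≤ 2 * cutoffTime t δ (j + 1) := by linarith
        have h5 : dilation t a δ j ^ 2 / δ ≤
            dilation t a δ j * (a / cutoffTime t δ (j + 1)) := by
          rw [div_le_iff₀ hδ, sq, mul_assoc]
          refine mul_le_mul_of_nonneg_left (h1.trans (le_of_eq ?_)) (hd j)
          ring
        have h6 := hd j
        calc 21 * cutoffTime t δ j * (dilation t a δ j ^ 2 / δ)
            ≤ 21 * (2 * cutoffTime t δ (j + 1)) *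
              (dilation t a δ j * (a / cutoffTime t δ (j + 1))) :=
              mul_le_mul (mul_le_mul_of_nonneg_left h4 (by norm_num)) h5 (by positivity)
                (by positivity)
          _ = 42 * a * dilation t a δ j := by field_simp; ring
    _ = 21 * a ^ 2 * Real.log t := by
        have hsum : ∑ j ∈ Finset.range N, (δ + dilation t a δ j) =
            t + a * (Real.log t / 2) := by
          simp_rw [← dilatedGrid_succ_sub ht]
          rw [Finset.sum_range_sub, dilatedGrid_zero ht, sub_zero, dilatedGrid_last ht hN]
        rw [Finset.sum_add_distrib, Finset.sum_const, Finset.card_range, nsmul_eq_mul, hN] at hsum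
        rw [← Finset.mul_sum, show ∑ j ∈ Finset.range N, dilation t a δ j =
          a * (Real.log t / 2) by linarith]
        ring

end DilatedGrid

/-! ### Cost of dilating time for the RSOS surface -/

section Dilation

variable {Ω : Type*} [MeasurableSpace Ω] {μ : Measure Ω} [IsProbabilityMeasure μ]
  {U : Ω → ℤ → Set ℝ} {t a δ : ℝ}

/-- Every dilated cell is cut at `s j + δ`: the first coin covers the original length, the second
the excess. -/
theorem IsPoissonClocks.exists_pairCoins (hU : IsPoissonClocks U μ) {s : ℕ → ℝ} {c : ℕ → ℝ}
    (hs0 : s 0 = 0) (hδ : 0 ≤ δ) (hc : ∀ j, 0 ≤ c j) (hs : ∀ j, s (j + 1) - s j = δ + c j) :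
    ∃ X, IsCoins μ X (fun i : (ℕ × ℤ) × Bool => 1 - Real.exp (-(if i.2 then c i.1.1 else δ))) ∧
      ∀ᵐ ω ∂μ, ∀ i, X i ω = true ↔ (U ω i.1.2 ∩ Ioc (if i.2 then s i.1.1 + δ else s i.1.1)
        (if i.2 then s (i.1.1 + 1) else s i.1.1 + δ)).Nonempty := by
  have hmono : Monotone s := monotone_nat_of_le_succ fun j => by linarith [hs j, hc j]
  have hpos : ∀ j, 0 ≤ s j := fun j => hs0 ▸ hmono (Nat.zero_le j)
  obtain ⟨X, hX, h⟩ := hU.exists_coins (x := fun i : (ℕ × ℤ) × Bool => i.1.2)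
    (a := fun i => if i.2 then s i.1.1 + δ else s i.1.1)
    (b := fun i => if i.2 then s (i.1.1 + 1) else s i.1.1 + δ)
    (fun i => by have := hpos i.1.1; split_ifs <;> linarith)
    (fun i => by have := hs i.1.1; have := hc i.1.1; split_ifs <;> linarith)
    (by
      rintro ⟨z, b⟩ ⟨w, b'⟩ hzw
      dsimp only
      by_cases h : z = w
      · subst h
        refine Set.disjoint_prod.2 (Or.inr ?_)
        have : b ≠ b' := fun h => hzw (by rw [h])
        cases b <;> cases b' <;> simp at this ⊢
      · refine (pairwise_disjoint_cells hmono (c := fun z => s (z.1 + 1)) (fun _ => le_rfl) h).mono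
          (Set.prod_mono_right (Ioc_subset_Ioc ?_ ?_)) (Set.prod_mono_right (Ioc_subset_Ioc ?_ ?_))
        all_goals
          have := hs z.1
          have := hc z.1
          have := hs w.1
          have := hc w.1
          split_ifs <;> linarith)
  refine ⟨X, ?_, h⟩
  convert hX using 6 with i
  have := hs i.1.1
  split_ifs <;> linarith

/-- The intermediate family `Y` dilates the cells in the cone only. Passing from full dilation to
`Y` is a coupling through pairs of coins, controlled by the finite speed of influence; passing from
`Y` to the undilated `X` compares laws, by the chi-square inequality. -/
theorem IsPoissonClocks.integral_gridHeight_sub_le (hU : IsPoissonClocks U μ) (ht : 1 ≤ t)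
    (ha : 0 ≤ a) (hat : a ≤ Real.sqrt t) (hδ : 0 < δ) (hδt : δ ≤ Real.sqrt t) {N : ℕ}
    (hN : N * δ = t) :
    ∫ ω, (gridHeight (clockCoins (U ω) (dilatedGrid t a δ)) (fun _ => 0) N 0 : ℝ) ∂μ -
      ∫ ω, (gridHeight (clockCoins (U ω) fun j => j * δ) (fun _ => 0) N 0 : ℝ) ∂μ ≤
      Real.sqrt (Var[fun ω => (gridHeight (clockCoins (U ω) fun j => j * δ) (fun _ => 0) N 0 : ℝ); μ]
        * Real.exp (21 * a ^ 2 * Real.log t)) +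
      Real.exp (-Real.sqrt t) * (t + a * (Real.log t / 2)) := by
  set s := dilatedGrid t a δ with hs
  set c := dilation t a δ with hc
  have hc0 : ∀ j, 0 ≤ c j := dilation_nonneg ht ha hδ.le
  have hs0 : s 0 = 0 := dilatedGrid_zero ht
  have hsc : ∀ j, s (j + 1) - s j = δ + c j := dilatedGrid_succ_sub ht
  have hmono : Monotone s := monotone_dilatedGrid ht ha hδ.le
  have hmono' : Monotone fun j : ℕ => (j : ℝ) * δ := fun i j hij =>
    mul_le_mul_of_nonneg_right (Nat.cast_le.2 hij) hδ.le
  set mask := coneMask t δ with hmask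
  obtain ⟨X, hX, hXU⟩ := hU.exists_clockCoins hmono' (by simp)
  obtain ⟨Z, hZ, hZU⟩ := hU.exists_pairCoins hs0 hδ.le hc0 hsc
  obtain ⟨Y, hY, hYU⟩ := hU.exists_coins (x := fun z : ℕ × ℤ => z.2) (a := fun z => s z.1)
    (b := fun z => s z.1 + (δ + if mask z then c z.1 else 0))
    (fun z => hs0 ▸ hmono (Nat.zero_le _))
    (fun z => by have := hc0 z.1; split_ifs <;> linarith)
    (pairwise_disjoint_cells hmono fun z => by
      have := hsc z.1; have := hc0 z.1; split_ifs <;> linarith)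
  have hall : ∀ᵐ ω ∂μ, maskedCoins (fun _ => true) (fun i => Z i ω) = clockCoins (U ω) s := by
    filter_upwards [hZU] with ω h
    funext z
    rw [Bool.eq_iff_iff, clockCoins_eq_true, maskedCoins, Bool.true_and, Bool.or_eq_true, h, h,
      ← Set.union_nonempty, ← Set.inter_union_distrib_left]
    simp only [Bool.false_eq_true, if_false, if_true]
    rw [Ioc_union_Ioc_eq_Ioc (by linarith) (by linarith [hsc z.1, hc0 z.1])]
  have hmsk : ∀ᵐ ω ∂μ, maskedCoins mask (fun i => Z i ω) = fun z => Y z ω := by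
    filter_upwards [hZU, hYU] with ω h h'
    funext z
    rw [Bool.eq_iff_iff, h', maskedCoins, Bool.or_eq_true, Bool.and_eq_true, h, h]
    simp only [Bool.false_eq_true, if_false, if_true]
    cases hz : mask z
    · simp
    · simp only [true_and, if_true]
      rw [← Set.union_nonempty, ← Set.inter_union_distrib_left,
        Ioc_union_Ioc_eq_Ioc (by linarith) (by linarith [hsc z.1, hc0 z.1])]
      rw [show s (z.1 + 1) = s z.1 + (δ + c z.1) by linarith [hsc z.1]]
  have hEX : ∫ ω, (gridHeight (clockCoins (U ω) fun j => j * δ) (fun _ => 0) N 0 : ℝ) ∂μ =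
      ∫ ω, (gridHeight (fun z => X z ω) (fun _ => 0) N 0 : ℝ) ∂μ :=
    integral_congr_ae (hXU.mono fun ω h => by simp only [h])
  have hVX : Var[fun ω => (gridHeight (clockCoins (U ω) fun j => j * δ) (fun _ => 0) N 0 : ℝ); μ] =
      Var[fun ω => (gridHeight (fun z => X z ω) (fun _ => 0) N 0 : ℝ); μ] :=
    variance_congr (hXU.mono fun ω h => by simp only [h])
  have hfar : ∫ ω, (gridHeight (clockCoins (U ω) s) (fun _ => 0) N 0 : ℝ) ∂μ -
      ∫ ω, (gridHeight (fun z => Y z ω) (fun _ => 0) N 0 : ℝ) ∂μ ≤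
        Real.exp (-Real.sqrt t) * (t + a * (Real.log t / 2)) := by
    have hP : 0 < ∏ i ∈ Finset.range N, (1 + 4 * (δ + c i)) :=
      Finset.prod_pos fun i _ => by linarith [hc0 i]
    -- `β` is normalized so that the product of growth factors cancels at the origin, leaving
    -- `exp(-√t)` times the total time.
    have h1 := integral_maskDiff_le (μ := μ) (mask := mask) (Δ := fun j => δ + c j) (K := N)
      (β := Real.exp (-Real.sqrt t) / ∏ i ∈ Finset.range N, (1 + 4 * (δ + c i))) hZ
      (div_nonneg (Real.exp_pos _).le hP.le)
      (fun i => by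
        rw [sub_nonneg, Real.exp_le_one_iff]
        have := hc0 i.1.1
        split_ifs <;> linarith)
      (fun z => by
        simp only [Bool.false_eq_true, if_false, if_true]
        linarith [one_sub_exp_neg_le δ, one_sub_exp_neg_le (c z.1)])
      (fun j x hj h => one_le_of_coneMask_eq_false ht ha hat hδ.le hN hj h) le_rfl 0
    have hsum : ∑ i ∈ Finset.range N, (δ + c i) = t + a * (Real.log t / 2) := by
      simp_rw [← hsc]
      rw [Finset.sum_range_sub, hs0, sub_zero, hs, dilatedGrid_last ht hN]
    rw [hsum, Int.cast_zero, Real.cosh_zero, mul_one] at h1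
    have e : Real.exp (-Real.sqrt t) / (∏ i ∈ Finset.range N, (1 + 4 * (δ + c i))) *
        (t + a * (Real.log t / 2)) * (∏ i ∈ Finset.range N, (1 + 4 * (δ + c i))) =
        Real.exp (-Real.sqrt t) * (t + a * (Real.log t / 2)) := by field_simp
    rw [e] at h1
    refine le_trans ?_ h1
    have hYI : Integrable (fun ω => (gridHeight (fun z => Y z ω) (fun _ => 0) N 0 : ℝ)) μ :=
      hY.integrable (dependsOn_gridHeight_cast _ N 0)
    have hsI := (hU.memLp_gridHeight hmono hs0 N 0).integrable one_le_two
    rw [← integral_sub hsI hYI]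
    refine integral_mono_ae (hsI.sub hYI) (hZ.integrable (dependsOn_maskDiff mask N 0)) ?_
    filter_upwards [hall, hmsk] with ω h h'
    simp only [maskDiff, h, h']
    push_cast
    exact le_abs_self _
  have hcone : ∫ ω, (gridHeight (fun z => Y z ω) (fun _ => 0) N 0 : ℝ) ∂μ -
      ∫ ω, (gridHeight (fun z => X z ω) (fun _ => 0) N 0 : ℝ) ∂μ ≤
      Real.sqrt (Var[fun ω => (gridHeight (fun z => X z ω) (fun _ => 0) N 0 : ℝ); μ] *
        Real.exp (21 * a ^ 2 * Real.log t)) := by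
    refine Real.le_sqrt_of_sq_le ?_
    have hδ1 : ∀ z : ℕ × ℤ, ((z.1 + 1 : ℕ) : ℝ) * δ - z.1 * δ = δ := fun z => by push_cast; ring
    refine (IsCoins.sq_integral_sub_le (φ := fun ξ => (gridHeight ξ (fun _ => 0) N 0 : ℝ)) hX hY
      (dependsOn_gridHeight_cast _ N 0) fun z => ?_).trans ?_
    · rw [hδ1]
      exact ⟨sub_pos.2 (Real.exp_lt_one_iff.2 (by linarith)), by linarith [Real.exp_pos (-δ)]⟩
    · refine mul_le_mul_of_nonneg_left ?_ (variance_nonneg _ _)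
      refine (sub_le_self _ zero_le_one).trans ?_
      set S : Finset ℤ := Finset.Icc (0 - (N : ℤ)) (0 + N)
      refine le_trans (b := ∏ z ∈ Finset.range N ×ˢ S,
        Real.exp (if mask z then c z.1 ^ 2 / δ else 0)) ?_ ?_
      · refine Finset.prod_le_prod (fun z _ => ?_) fun z _ => ?_
        · rw [hδ1]
          have h1 := Real.exp_pos (-δ)
          have h2 : 0 ≤ 1 - Real.exp (-δ) := sub_nonneg.2 (Real.exp_le_one_iff.2 (by linarith))
          have h3 : 0 ≤ 1 - (1 - Real.exp (-δ)) := by linarith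
          positivity
        · rw [hδ1, add_sub_cancel_left]
          refine le_trans ?_ (Real.add_one_le_exp _)
          rw [add_comm]
          refine add_le_add_left ?_ 1
          have := chiSquare_coin_le (c := if mask z then c z.1 else 0) hδ
            (by have := hc0 z.1; split_ifs <;> linarith)
          refine this.trans (le_of_eq ?_)
          split_ifs <;> simp
      · rw [← Real.exp_sum, Real.exp_le_exp]
        exact sum_chiSquare_le ht ha hδ hδt hN S
  rw [hEX, hVX]
  linarith

theorem isGridSequence_uniform (ht : 0 ≤ t) :
    IsGridSequence (fun n j => j * (t / (n + 1 : ℕ))) (fun n => n + 1) t where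
  mono n i j hij := mul_le_mul_of_nonneg_right (Nat.cast_le.2 hij) (by positivity)
  zero n := by simp
  last n := by field_simp
  mesh η hη := by
    filter_upwards [eventually_div_lt t hη] with n hn j _
    have : ((j + 1 : ℕ) : ℝ) * (t / (n + 1 : ℕ)) - j * (t / (n + 1 : ℕ)) = t / (n + 1 : ℕ) := by
      push_cast; ring
    rwa [this]

theorem IsPoissonClocks.integral_rsosHeight_sub_le (hU : IsPoissonClocks U μ) (ht : 1 ≤ t)
    (ha : 0 ≤ a) (hat : a ≤ Real.sqrt t) :
    ∫ ω, (rsosHeight (U ω) (fun _ => 0) (t + a * (Real.log t / 2)) 0 : ℝ) ∂μ -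
      ∫ ω, (rsosHeight (U ω) (fun _ => 0) t 0 : ℝ) ∂μ ≤
      Real.sqrt (Var[fun ω => (rsosHeight (U ω) (fun _ => 0) t 0 : ℝ); μ] *
        Real.exp (21 * a ^ 2 * Real.log t)) +
      Real.exp (-Real.sqrt t) * (t + a * (Real.log t / 2)) := by
  have h1 := isGridSequence_uniform (t := t) (by linarith)
  have h2 := isGridSequence_dilated ht ha
  refine le_of_tendsto_of_tendsto
    ((hU.tendsto_integral_gridHeight h2).sub (hU.tendsto_integral_gridHeight h1))
    ((((hU.tendsto_variance_gridHeight h1).mul_const _).sqrt).add_const _) ?_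
  have hs : 0 < Real.sqrt t := Real.sqrt_pos.2 (by linarith)
  filter_upwards [eventually_div_lt t hs] with n hn
  exact hU.integral_gridHeight_sub_le ht ha hat (by positivity) hn.le (by field_simp)

end Dilation

/-! ### Comparison of the two bounds -/

section Main

variable {Ω : Type*} [MeasurableSpace Ω] {μ : Measure Ω} [IsProbabilityMeasure μ]
  {U : Ω → ℤ → Set ℝ}

theorem eventually_exp_neg_sqrt_mul_le :
    ∀ᶠ t : ℝ in atTop, Real.exp (-Real.sqrt t) * (61 * t) ≤ 1 / 2 := by
  have h := ((Real.tendsto_pow_mul_exp_neg_atTop_nhds_zero 2).comp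
    Real.tendsto_sqrt_atTop).const_mul 61
  rw [mul_zero] at h
  filter_upwards [h.eventually_le_const (by norm_num : (0 : ℝ) < 1 / 2), eventually_ge_atTop 0]
    with t ht h0
  simp only [Function.comp_apply, Real.sq_sqrt h0] at ht
  linarith

theorem IsPoissonClocks.eventually_le_variance (hU : IsPoissonClocks U μ) :
    ∀ᶠ t : ℝ in atTop, Real.exp (-302400) / 4000 ≤
      Var[fun ω => (rsosHeight (U ω) (fun _ => 0) t 0 : ℝ); μ] / Real.log t := by
  -- `14400 = 120²` ensures `a ≤ 120 ≤ √t` for the `a` below.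
  filter_upwards [eventually_exp_neg_sqrt_mul_le, eventually_ge_atTop 14400,
    Real.tendsto_log_atTop.eventually_ge_atTop 1] with t herr ht hlog
  set L := Real.log t with hL
  set v := Var[fun ω => (rsosHeight (U ω) (fun _ => 0) t 0 : ℝ); μ] with hv
  have hv0 : 0 ≤ v := variance_nonneg _ _
  set l := ⌊Real.sqrt L⌋₊ with hl
  have hs1 : 1 ≤ Real.sqrt L := Real.one_le_sqrt.2 hlog
  have hl1 : 1 ≤ l := Nat.le_floor (by simpa using hs1)
  have hl1' : (1 : ℝ) ≤ l := by exact_mod_cast hl1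
  have hle : (l : ℝ) ≤ Real.sqrt L := Nat.floor_le (Real.sqrt_nonneg _)
  have hge : Real.sqrt L ≤ 2 * l := by linarith [Nat.lt_floor_add_one (Real.sqrt L)]
  have hsq := Real.sq_sqrt (by linarith : 0 ≤ L)
  have hl2 : (l : ℝ) ^ 2 ≤ L := hsq ▸ pow_le_pow_left₀ (by linarith) hle 2
  have hl4 : L ≤ 4 * (l : ℝ) ^ 2 := by nlinarith
  have hE0 := Real.exp_pos (-302400)
  have hE1 : Real.exp (-302400) ≤ 1 := Real.exp_le_one_iff.2 (by norm_num)
  rw [le_div_iff₀ (by linarith)]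
  -- If `v ≥ l² / 1000`, then `L ≤ 4 l²` already gives `v ≥ L / 4000`. Otherwise the flat surface
  -- must grow.
  rcases le_or_gt ((l : ℝ) ^ 2 / 1000) v with hcase | hcase
  · have : Real.exp (-302400) / 4000 * L ≤ 1 / 4000 * L :=
      mul_le_mul_of_nonneg_right (by linarith) (by linarith)
    linarith
  have hgrow := hU.le_integral_rsosHeight_sub (by linarith) hl1 hcase
  -- Chosen so that the dilation gains exactly the time `60 l`. The exponent `21 a² L` is then
  -- `302400 l² / L`, at most `302400`.
  set a := 120 * (l : ℝ) / L with ha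
  have ha0 : 0 ≤ a := by positivity
  have haL : a * (L / 2) = 60 * l := by rw [ha]; field_simp; norm_num
  have ha120 : a ≤ 120 := by
    rw [ha, div_le_iff₀ (by linarith)]
    nlinarith
  have hst : (120 : ℝ) ≤ Real.sqrt t := Real.le_sqrt_of_sq_le (by linarith)
  have hup := hU.integral_rsosHeight_sub_le (by linarith) ha0 (ha120.trans hst)
  rw [← hL, haL, ← hv] at hup
  have hlt : (l : ℝ) ≤ t := by
    have := Real.log_le_sub_one_of_pos (by linarith : 0 < t)
    nlinarith
  have herr' : Real.exp (-Real.sqrt t) * (t + 60 * l) ≤ 1 / 2 :=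
    (mul_le_mul_of_nonneg_left (by linarith) (Real.exp_pos _).le).trans herr
  have hexp : Real.exp (21 * a ^ 2 * L) ≤ Real.exp 302400 := by
    rw [Real.exp_le_exp, ha, div_pow, show (21 : ℝ) * ((120 * l) ^ 2 / L ^ 2) * L =
      302400 * l ^ 2 / L by field_simp; ring, div_le_iff₀ (by linarith)]
    linarith
  -- The truncation error is at most `1/2`, hence at most `l / 2`, and half of the gain `l` is left.
  have hsqrt : (l : ℝ) / 2 ≤ Real.sqrt (v * Real.exp 302400) := by
    have := Real.sqrt_le_sqrt (mul_le_mul_of_nonneg_left hexp hv0)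
    linarith
  have h1 : ((l : ℝ) / 2) ^ 2 ≤ v * Real.exp 302400 := by
    rw [← Real.sq_sqrt (by positivity : 0 ≤ v * Real.exp 302400)]
    exact pow_le_pow_left₀ (by positivity) hsqrt 2
  have h2 : Real.exp (-302400) * ((l : ℝ) / 2) ^ 2 ≤ v := by
    rw [Real.exp_neg, inv_mul_le_iff₀ (Real.exp_pos _)]
    linarith
  nlinarith

end Main

theorem mainTheorem2 {Ω : Type*} [MeasurableSpace Ω] (μ : Measure Ω) [IsProbabilityMeasure μ]
    (U : Ω → ℤ → Set ℝ) (hU : IsPoissonClocks U μ) :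
    (∀ t : ℝ, 0 ≤ t → MemLp (fun ω => (rsosHeight (U ω) (fun _ => 0) t 0 : ℝ)) 2 μ) ∧
      (0 : EReal) < liminf
        (fun t : ℝ =>
          ((variance (fun ω => (rsosHeight (U ω) (fun _ => 0) t 0 : ℝ)) μ / Real.log t : ℝ) : EReal))
        atTop := by
  refine ⟨fun t ht => hU.memLp_rsosHeight (isGridSequence_uniform ht), ?_⟩
  have hc : (0 : EReal) < ((Real.exp (-302400) / 4000 : ℝ) : EReal) :=
    EReal.coe_pos.2 (by positivity)
  refine hc.trans_le (le_liminf_of_le (by isBoundedDefault) ?_)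
  filter_upwards [hU.eventually_le_variance] with t ht
  exact EReal.coe_le_coe_iff.2 ht
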